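/- **Theorem (Linear Finite Field Networks).** Let $q$ be a prime and let $G=(V,E)$ be a finite directed graph with senders $t_1,\dots,t_K\in V$ and a receiver $d\in V\setminus\{t_1,\dots,t_K\}$, such that every node has a directed path to $d$. In channel use $t$ node $u$ transmits $x_u^{(t)}\in\mathbb F_q^{\alpha_u}$, and node $v$ receives $$y_v^{(t)}=\sum_{u:(u,v)\in E}h_{u,v}\,x_u^{(t)}\in\mathbb F_q^{\beta_v},$$ where the $h_{u,v}\in\mathbb F_q^{\beta_v\times\alpha_u}$ are fixed matrices. Let $\mathbf S=(S_1,\dots,S_K)$ be a random vector in $\{0,\dots,p-1\}^K$ with an arbitrary joint distribution, and let $\mathbf s[1],\mathbf s[2],\dots$ be independent copies of $\mathbf S$. The desired function $f$ is either an arithmetic sum function $f(\mathbf s)=\big(\sum_{i=1}^K a_{li}s_i\big)_{l=1}^L$ with $a_{li}\in\{0,\dots,p-1\}$, or the type function $f(\mathbf s)=\big(|\{i:s_i=l\}|\big)_{l=0}^{p-1}$. Assume that the entropy $H(f(\mathbf S))$ is positive. In a length-$n$ block code for $k$ function values, in channel use $t\in\{1,\dots,n\}$ sender $t_i$ transmits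 a function of $(s_i[1],\dots,s_i[k])$ and of $y_{t_i}^{(1)},\dots,y_{t_i}^{(t-1)}$, any other node $v\neq d$ transmits a function of $y_v^{(1)},\dots,y_v^{(t-1)}$, the receiver transmits nothing (that is, $0$), and after $n$ channel uses the receiver estimates $f(\mathbf s[1]),\dots,f(\mathbf s[k])$ from $y_d^{(1)},\dots,y_d^{(n)}$. (A node hosting several senders uses the source blocks of all of them.) The error probability is the probability that at least one of the $k$ estimates is wrong. A rate $R$ is achievable if there are length-$n$ block codes for $k_n$ function values, $n=1,2,\dots$, with $k_n/n\to R$ and error probability tending to $0$; the computation capacity is the maximum of all achievable rates. For $\Sigma\subseteq\{1,\dots,K\}$ let $G(\Sigma)$ be the subgraph of $G$ induced on the set $V(\Sigma)$ of nodes that have a directed path (possibly of length $0$) from some $t_i$, $i\in\Sigma$. Let $\Lambda(\Sigma)$ be the set of all $\Omega\subseteq V(\Sigma)$ with $t_i\in\Omega$ for all $i\in\Sigma$ and $d\notin\Omega$. For $\Omega\in\Lambda(\Sigma)$ let $H_\Omega(\Sigma)$ be the transfer matrix over $\mathbb F_q$ from $(x_u)_{u\in\Omega}$ to $(y_v)_{v\in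 V(\Sigma)\setminus\Omega}$, whose $(v,u)$ block is $h_{u,v}$ if $(u,v)\in E$ and $0$ otherwise. If $q>(p-1)^2K$ and $$\min_{\Omega\in\Lambda(\{1,\dots,K\})}\operatorname{rank}H_\Omega(\{1,\dots,K\})=\min_{1\le i\le K}\ \min_{\Omega\in\Lambda(\{i\})}\operatorname{rank}H_\Omega(\{i\}),$$ then the computation capacity for $f$ equals $$\frac{\Big(\min_{1\le i\le K}\min_{\Omega\in\Lambda(\{i\})}\operatorname{rank}H_\Omega(\{i\})\Big)\log q}{H(f(\mathbf S))},$$ where the logarithm and the entropy are taken to the same base (equivalently, the capacity is the min-cut rank divided by the entropy in base $q$). -/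

import Mathlib

/-- A linear finite field network over `ZMod q` (`q` prime) on a directed graph with node set `V`,
with `K` senders and one receiver. Node `u` transmits a vector of length `inDim u` in each channel
use, node `v` receives a vector of length `outDim v`, and `chan u v` is the channel matrix from `u`
to `v` (it is used only if `(u, v)` is an edge). -/
structure FiniteFieldNetwork (q K : ℕ) (V : Type*) where
  graph : Digraph V
  inDim : V → ℕ
  outDim : V → ℕ
  chan : ∀ u v : V, Matrix (Fin (outDim v)) (Fin (inDim u)) (ZMod q)
  sender : Fin K → V
  receiver : V
  sender_ne_receiver : ∀ i, sender i ≠ receiver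
  path_to_receiver : ∀ v, Relation.ReflTransGen graph.Adj v receiver

namespace FiniteFieldNetwork

noncomputable section

open scoped Classical

variable {q K : ℕ} {V : Type*} [Fintype V]

/-- One channel use: the vector received at `v` is the sum over the in-neighbours `u` of `v` of
`chan u v` times the vector transmitted by `u`. -/
def channelOutput (N : FiniteFieldNetwork q K V) (x : ∀ u, Fin (N.inDim u) → ZMod q) (v : V) :
    Fin (N.outDim v) → ZMod q :=
  ∑ u : V, if N.graph.Adj u v then (N.chan u v).mulVec (x u) else 0

/-- The nodes of the subgraph `G(T)`: those that have a directed path (possibly of length zero)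
from at least one of the senders with index in `T`. -/
def reachable (N : FiniteFieldNetwork q K V) (T : Set (Fin K)) : Set V :=
  {v | ∃ i ∈ T, Relation.ReflTransGen N.graph.Adj (N.sender i) v}

/-- `Ω` is a cut of `G(T)` that separates all senders with index in `T` from the receiver. -/
def IsCut (N : FiniteFieldNetwork q K V) (T : Set (Fin K)) (Ω : Finset V) : Prop :=
  (∀ v ∈ Ω, v ∈ N.reachable T) ∧ (∀ i ∈ T, N.sender i ∈ Ω) ∧ N.receiver ∉ Ω

/-- The transfer matrix of the cut `Ω` of `G(T)`: it maps the inputs of the nodes in `Ω` to the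
outputs of the nodes of `G(T)` outside `Ω`; its `(v, u)` block is the channel matrix from `u` to
`v` if `(u, v)` is an edge, and zero otherwise. -/
def transferMatrix (N : FiniteFieldNetwork q K V) (T : Set (Fin K)) (Ω : Finset V) :
    Matrix ((v : {v : V // v ∈ N.reachable T ∧ v ∉ Ω}) × Fin (N.outDim v.1))
      ((u : {u : V // u ∈ Ω}) × Fin (N.inDim u.1)) (ZMod q) :=
  Matrix.of fun b a => if N.graph.Adj a.1.1 b.1.1 then N.chan a.1.1 b.1.1 b.2 a.2 else 0

/-- The minimum of the rank of the transfer matrix over all cuts of `G(T)` that separate the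
senders with index in `T` from the receiver. -/
def minCutRank (N : FiniteFieldNetwork q K V) (T : Set (Fin K)) : ℕ :=
  sInf {r : ℕ | ∃ Ω : Finset V, N.IsCut T Ω ∧ r = (N.transferMatrix T Ω).rank}

/-- A length-`n` block code for computing `k` function values in `Y` from sources with alphabet
`Fin p`. In channel use number `t` (counted from `0`) node `v` transmits a function of the
length-`k` source blocks that it observes (none if `v` is a relay) and of the `t` vectors that it
has received so far. Only the values of `encode` at `t < n` and at nodes other than the receiver
are ever used. The receiver estimates the `j`-th function value by `decode j`. -/
structure BlockCode (N : FiniteFieldNetwork q K V) (p : ℕ) (Y : Type*) (k n : ℕ) where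
  encode : ∀ (v : V) (t : ℕ), ({i : Fin K // N.sender i = v} → Fin k → Fin p) →
    (Fin t → Fin (N.outDim v) → ZMod q) → (Fin (N.inDim v) → ZMod q)
  decode : Fin k → (Fin n → Fin (N.outDim N.receiver) → ZMod q) → Y

variable {N : FiniteFieldNetwork q K V} {p : ℕ} {Y : Type*} {k n : ℕ}

/-- The vectors received at the nodes during the first `t` channel uses, when the source vector at
time `j` is `s j`. The receiver is silent, that is, it transmits zero. -/
def BlockCode.received (c : N.BlockCode p Y k n) (s : Fin k → Fin K → Fin p) :
    ∀ (t : ℕ) (v : V), Fin t → Fin (N.outDim v) → ZMod q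
  | 0, _ => fun τ => τ.elim0
  | t + 1, v =>
    Fin.snoc (α := fun _ => Fin (N.outDim v) → ZMod q) (BlockCode.received c s t v)
      (N.channelOutput
        (fun u => if u = N.receiver then 0
          else c.encode u t (fun i j => s j i.1) (BlockCode.received c s t u)) v)

/-- The probability, for source vectors `s 0, …, s (k - 1)` drawn independently from `P`, that at
least one of the `k` function values is estimated incorrectly. -/
def BlockCode.errorProb (c : N.BlockCode p Y k n) (P : PMF (Fin K → Fin p))
    (f : (Fin K → Fin p) → Y) : ℝ :=
  ∑ s : Fin k → Fin K → Fin p,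
    if ∃ j, c.decode j (c.received s n N.receiver) ≠ f (s j) then ∏ j, (P (s j)).toReal else 0

/-- `R` is an achievable computation rate for `f`: there is a sequence of length-`n` block codes
computing `k n` function values, with `k n / n → R` and error probability tending to zero. -/
def AchievableRate (N : FiniteFieldNetwork q K V) (P : PMF (Fin K → Fin p))
    (f : (Fin K → Fin p) → Y) (R : ℝ) : Prop :=
  ∃ (k : ℕ → ℕ) (c : ∀ n, N.BlockCode p Y (k n) n),
    Filter.Tendsto (fun n => (k n : ℝ) / (n : ℝ)) Filter.atTop (nhds R) ∧
    Filter.Tendsto (fun n => (c n).errorProb P f) Filter.atTop (nhds 0)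

/-- `C` is the computation capacity for `f`: the maximum of all achievable computation rates. -/
def IsComputationCapacity (N : FiniteFieldNetwork q K V) (P : PMF (Fin K → Fin p))
    (f : (Fin K → Fin p) → Y) (C : ℝ) : Prop :=
  IsGreatest {R : ℝ | N.AchievableRate P f R} C

end

end FiniteFieldNetwork

open scoped Classical in
/-- The Shannon entropy (in nats) of `f(S)`, where `S` has the probability mass function `P` on a
finite set. -/
noncomputable def pmfEntropy {X Y : Type*} [Fintype X] (P : PMF X) (f : X → Y) : ℝ :=
  ∑ y ∈ Finset.univ.image f, Real.negMulLog (∑ x with f x = y, (P x).toReal)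

/-- The arithmetic sum function `s ↦ (∑ i, a l i * s i)_l`. -/
def arithmeticSum {K p L : ℕ} (a : Fin L → Fin K → Fin p) (s : Fin K → Fin p) : Fin L → ℕ :=
  fun l => ∑ i, (a l i : ℕ) * (s i : ℕ)

/-- The type function: the number of occurrences in `s` of each symbol `l`. -/
def typeFunction {K p : ℕ} (s : Fin K → Fin p) : Fin p → ℕ :=
  fun l => ∑ i, if s i = l then 1 else 0

/-! Achievability rests on linearity. Modulo `q` the function is a sum `∑ i, g i (s i)` of one term
per sender, and its residues determine it because its values stay below `q`. If every sender applies
the same linear hash `B` to its own transformed block and the network adds the results, the receiver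
obtains `B` of the residues of the whole value sequence. Slightly more than `k * H / log q` hash
symbols single this sequence out among the likely ones (`card_likelySeqs_mul_le`,
`exists_linear_hash`), so the sources never have to be recovered individually.

It remains to make the network add. For a nonzero message of sender `i`, the nodes that know a
nonzero linear image of it form a cut of `G({i})` as long as the receiver is not among them. A
random linear step leaves this set unchanged with probability at most `q ^ (-r)`, where `r` bounds
all individual min-cut ranks from below (`card_informed_eq_mul_le`). The set can grow fewer than
`|V|` times, so the receiver stays uninformed after `n` uses with probability at most a polynomial
in `n` times `q ^ (-r * n)`. A union bound over messages then makes all end-to-end maps injective on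
slightly fewer than `n * r` symbols (`exists_linearSteps`). One receiver map makes all of them
surjective onto a space smaller by a constant number of symbols (`exists_common_surjective`), and
precoding with right inverses turns each into the identity. The receiver therefore sees a plain sum
(`exists_code`).

For the converse, at most `q ^ (r * n)` reception histories are possible beyond a joint cut of rank
`r` (`card_image_received_le`), hence at most that many estimate sequences. Those that are not
likely have probability at most `exp (-k (H - ε))` each, so above the claimed rate the error cannot
vanish (`one_le_errorProb_add`). The cut hypothesis makes the two bounds meet. -/

open Filter Topology

/-! ### Large deviations and typical value sequences -/

open scoped Classical in
/-- Chernoff bound: sums of independent copies of a variable with negative mean are nonnegative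
with exponentially small probability. -/
theorem exists_tail_le_pow {X : Type*} [Fintype X] (P a : X → ℝ) (hP : ∀ x, 0 ≤ P x)
    (hs : ∑ x, P x = 1) (ha : ∑ x, P x * a x < 0) :
    ∃ ρ : ℝ, 0 ≤ ρ ∧ ρ < 1 ∧ ∀ k : ℕ,
      ∑ s : Fin k → X, (if 0 ≤ ∑ j, a (s j) then ∏ j, P (s j) else 0) ≤ ρ ^ k := by
  set h : ℝ → ℝ := fun c => ∑ x, P x * Real.exp (c * a x) with hh
  have hd : HasDerivAt h (∑ x, P x * a x) 0 := by
    have : ∀ x ∈ Finset.univ,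
        HasDerivAt (fun c => P x * Real.exp (c * a x)) (P x * a x) 0 := by
      intro x _
      have h1 : HasDerivAt (fun c : ℝ => c * a x) (a x) 0 := by
        simpa using (hasDerivAt_id (0 : ℝ)).mul_const (a x)
      simpa using (h1.exp).const_mul (P x)
    simpa [hh] using HasDerivAt.fun_sum this
  have h0 : h 0 = 1 := by simp [hh, hs]
  -- The moment generating function `h` equals `1` at `0` and has the negative mean as its
  -- derivative there, so it drops below `1` just to the right of `0`.
  obtain ⟨c, hc, hc1⟩ : ∃ c : ℝ, 0 < c ∧ h c < 1 := by
    have h1 := (hasDerivAt_iff_tendsto_slope.1 hd).eventually (gt_mem_nhds ha)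
    have h2 : ∀ᶠ c in nhdsWithin (0 : ℝ) (Set.Ioi 0), slope h 0 c < 0 :=
      h1.filter_mono (nhdsWithin_mono _ (fun x hx => ne_of_gt hx))
    obtain ⟨c, hc, hc0⟩ := (h2.and self_mem_nhdsWithin).exists
    have hc0 : 0 < c := hc0
    refine ⟨c, hc0, ?_⟩
    rw [slope_def_field, h0, sub_zero, div_lt_iff₀ hc0] at hc
    linarith
  refine ⟨h c, Finset.sum_nonneg fun x _ => mul_nonneg (hP x) (Real.exp_pos _).le, hc1, ?_⟩
  intro k
  rw [hh, Fintype.sum_pow]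
  refine Finset.sum_le_sum fun s _ => ?_
  rw [Finset.prod_mul_distrib, ← Real.exp_sum, ← Finset.mul_sum]
  have hp : 0 ≤ ∏ j, P (s j) := Finset.prod_nonneg fun j _ => hP _
  split_ifs with h1
  · exact le_mul_of_one_le_right hp (Real.one_le_exp (mul_nonneg hc.le h1))
  · positivity

section Entropy

open scoped Classical

variable {X Y : Type*} [Fintype X]

theorem sum_toReal_pmf (P : PMF X) : ∑ x, (P x).toReal = 1 := by
  have h := P.tsum_coe
  rw [tsum_fintype] at h
  rw [← ENNReal.toReal_sum fun x _ => P.apply_ne_top x, h, ENNReal.toReal_one]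

theorem sum_prod_toReal_pmf (P : PMF X) (k : ℕ) :
    ∑ s : Fin k → X, ∏ j, (P (s j)).toReal = 1 := by
  rw [← Fintype.sum_pow (fun x => (P x).toReal) k, sum_toReal_pmf, one_pow]

/-- The probability of the value `y` of `f`. -/
noncomputable def valueProb (P : PMF X) (f : X → Y) (y : Y) : ℝ :=
  ∑ x with f x = y, (P x).toReal

theorem valueProb_nonneg (P : PMF X) (f : X → Y) (y : Y) : 0 ≤ valueProb P f y :=
  Finset.sum_nonneg fun _ _ => ENNReal.toReal_nonneg

theorem valueProb_pos (P : PMF X) (f : X → Y) {x : X} (hx : 0 < (P x).toReal) :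
    0 < valueProb P f (f x) :=
  lt_of_lt_of_le hx (Finset.single_le_sum (f := fun x => (P x).toReal)
    (fun _ _ => ENNReal.toReal_nonneg) (by simp))

theorem sum_mul_comp_eq (P : PMF X) (f : X → Y) (g : Y → ℝ) :
    ∑ x, (P x).toReal * g (f x) = ∑ y ∈ Finset.univ.image f, valueProb P f y * g y := by
  rw [← Finset.sum_fiberwise_of_maps_to (t := Finset.univ.image f) (g := f) (by simp)]
  refine Finset.sum_congr rfl fun y _ => ?_
  rw [valueProb, Finset.sum_mul]
  refine Finset.sum_congr rfl fun x hx => ?_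
  rw [(Finset.mem_filter.1 hx).2]

theorem sum_valueProb (P : PMF X) (f : X → Y) :
    ∑ y ∈ Finset.univ.image f, valueProb P f y = 1 := by
  have := sum_mul_comp_eq P f (fun _ => 1)
  simpa [sum_toReal_pmf] using this.symm

theorem sum_neg_log_valueProb (P : PMF X) (f : X → Y) :
    ∑ x, (P x).toReal * (-Real.log (valueProb P f (f x))) = pmfEntropy P f := by
  rw [sum_mul_comp_eq P f (fun y => -Real.log (valueProb P f y)), pmfEntropy]
  refine Finset.sum_congr rfl fun y _ => ?_
  rw [Real.negMulLog, valueProb]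
  ring

theorem log_prod_valueProb (P : PMF X) (f : X → Y) {k : ℕ} {s : Fin k → X}
    (hs : ∀ j, 0 < (P (s j)).toReal) :
    Real.log (∏ j, valueProb P f (f (s j))) = ∑ j, Real.log (valueProb P f (f (s j))) :=
  Real.log_prod fun j _ => (valueProb_pos P f (hs j)).ne'

/-- The value sequences of `f` of length `k` whose probability exceeds `δ`. -/
noncomputable def likelySeqs (P : PMF X) (f : X → Y) (k : ℕ) (δ : ℝ) : Finset (Fin k → Y) :=
  (Fintype.piFinset fun _ : Fin k => Finset.univ.image f).filter
    fun u => δ < ∏ j, valueProb P f (u j)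

theorem sum_prod_valueProb (P : PMF X) (f : X → Y) (k : ℕ) :
    ∑ u ∈ Fintype.piFinset (fun _ : Fin k => Finset.univ.image f), ∏ j, valueProb P f (u j)
      = 1 := by
  rw [← Finset.prod_univ_sum]
  simp [sum_valueProb]

/-- The sequences counted have total probability at most one, and each has more than `δ`. -/
theorem card_likelySeqs_mul_le (P : PMF X) (f : X → Y) (k : ℕ) (δ : ℝ) :
    ((likelySeqs P f k δ).card : ℝ) * δ ≤ 1 := by
  rw [← sum_prod_valueProb P f k, ← nsmul_eq_mul, ← Finset.sum_const]
  refine (Finset.sum_le_sum fun u hu => (Finset.mem_filter.1 hu).2.le).trans ?_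
  exact Finset.sum_le_sum_of_subset_of_nonneg (Finset.filter_subset _ _)
    fun u _ _ => Finset.prod_nonneg fun j _ => valueProb_nonneg P f _

/-- Value sequences with probability at most `exp (-k (H + ε))` are exponentially rare. -/
theorem exists_prob_unlikely_le (P : PMF X) (f : X → Y) {ε : ℝ} (hε : 0 < ε) :
    ∃ ρ : ℝ, 0 ≤ ρ ∧ ρ < 1 ∧ ∀ k : ℕ,
      ∑ s : Fin k → X, (if (fun j => f (s j)) ∉
        likelySeqs P f k (Real.exp (-(k * (pmfEntropy P f + ε)))) then
          ∏ j, (P (s j)).toReal else 0) ≤ ρ ^ k := by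
  obtain ⟨ρ, h0, h1, h2⟩ := exists_tail_le_pow (fun x => (P x).toReal)
    (fun x => -Real.log (valueProb P f (f x)) - (pmfEntropy P f + ε))
    (fun x => ENNReal.toReal_nonneg) (sum_toReal_pmf P) (by
      simp only [mul_sub, Finset.sum_sub_distrib, sum_neg_log_valueProb, ← Finset.sum_mul,
        sum_toReal_pmf]
      linarith)
  refine ⟨ρ, h0, h1, fun k => (Finset.sum_le_sum fun s _ => ?_).trans (h2 k)⟩
  have hp : 0 ≤ ∏ j, (P (s j)).toReal := Finset.prod_nonneg fun j _ => ENNReal.toReal_nonneg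
  -- Source blocks of probability zero are set aside, since logarithms of their value probabilities
  -- carry no information.
  rcases hp.eq_or_lt with hp | hp
  · simp [← hp]
  have hpos : ∀ j, 0 < (P (s j)).toReal := fun j =>
    lt_of_le_of_ne ENNReal.toReal_nonneg fun h0 => hp.ne' (Finset.prod_eq_zero (Finset.mem_univ j)
      h0.symm)
  by_cases hT : (fun j => f (s j)) ∈ likelySeqs P f k (Real.exp (-(k * (pmfEntropy P f + ε))))
  · rw [if_neg (not_not.2 hT)]
    split_ifs <;> first | exact hp.le | exact le_rfl
  · rw [if_pos hT, if_pos]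
    simp only [likelySeqs, Finset.mem_filter, Fintype.mem_piFinset, not_and, not_lt] at hT
    have hle := hT fun j => by simp
    have hlog := Real.log_le_log (Finset.prod_pos fun j _ => valueProb_pos P f (hpos j)) hle
    rw [log_prod_valueProb P f hpos, Real.log_exp] at hlog
    simp only [Finset.sum_sub_distrib, Finset.sum_neg_distrib, Finset.sum_const, Finset.card_univ,
      Fintype.card_fin, nsmul_eq_mul]
    linarith

/-- Value sequences with probability exceeding `exp (-k (H - ε))` are exponentially rare. -/
theorem exists_prob_likely_le (P : PMF X) (f : X → Y) {ε : ℝ} (hε : 0 < ε) :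
    ∃ ρ : ℝ, 0 ≤ ρ ∧ ρ < 1 ∧ ∀ k : ℕ,
      ∑ s : Fin k → X, (if (fun j => f (s j)) ∈
        likelySeqs P f k (Real.exp (-(k * (pmfEntropy P f - ε)))) then
          ∏ j, (P (s j)).toReal else 0) ≤ ρ ^ k := by
  obtain ⟨ρ, h0, h1, h2⟩ := exists_tail_le_pow (fun x => (P x).toReal)
    (fun x => (pmfEntropy P f - ε) - -Real.log (valueProb P f (f x)))
    (fun x => ENNReal.toReal_nonneg) (sum_toReal_pmf P) (by
      simp only [mul_sub, Finset.sum_sub_distrib, sum_neg_log_valueProb, ← Finset.sum_mul,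
        sum_toReal_pmf]
      linarith)
  refine ⟨ρ, h0, h1, fun k => (Finset.sum_le_sum fun s _ => ?_).trans (h2 k)⟩
  have hp : 0 ≤ ∏ j, (P (s j)).toReal := Finset.prod_nonneg fun j _ => ENNReal.toReal_nonneg
  rcases hp.eq_or_lt with hp | hp
  · simp [← hp]
  have hpos : ∀ j, 0 < (P (s j)).toReal := fun j =>
    lt_of_le_of_ne ENNReal.toReal_nonneg fun h0 => hp.ne' (Finset.prod_eq_zero (Finset.mem_univ j)
      h0.symm)
  by_cases hT : (fun j => f (s j)) ∈ likelySeqs P f k (Real.exp (-(k * (pmfEntropy P f - ε))))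
  · rw [if_pos hT, if_pos]
    have hle := (Finset.mem_filter.1 hT).2
    have hlog := Real.log_le_log (Real.exp_pos _) hle.le
    rw [log_prod_valueProb P f hpos, Real.log_exp] at hlog
    simp only [Finset.sum_sub_distrib, Finset.sum_neg_distrib, Finset.sum_const, Finset.card_univ,
      Fintype.card_fin, nsmul_eq_mul]
    linarith
  · rw [if_neg hT]
    split_ifs <;> first | exact hp.le | exact le_rfl

theorem prod_valueProb (P : PMF X) (f : X → Y) {k : ℕ} (u : Fin k → Y) :
    ∏ j, valueProb P f (u j) =
      ∑ s : Fin k → X, if (fun j => f (s j)) = u then ∏ j, (P (s j)).toReal else 0 := by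
  simp only [valueProb]
  rw [Finset.prod_univ_sum, ← Finset.sum_filter]
  refine Finset.sum_congr ?_ fun _ _ => rfl
  ext s
  simp [Fintype.mem_piFinset, funext_iff]

/-- The probability that the value sequence lies in a small finite set. -/
theorem sum_mem_le (P : PMF X) (f : X → Y) (k : ℕ) (D : Finset (Fin k → Y)) {δ : ℝ} (hδ : 0 ≤ δ) :
    ∑ s : Fin k → X, (if (fun j => f (s j)) ∈ D then ∏ j, (P (s j)).toReal else 0) ≤
      (∑ s : Fin k → X, (if (fun j => f (s j)) ∈ likelySeqs P f k δ then
          ∏ j, (P (s j)).toReal else 0)) + D.card * δ := by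
  have hp : ∀ s : Fin k → X, 0 ≤ ∏ j, (P (s j)).toReal := fun s =>
    Finset.prod_nonneg fun j _ => ENNReal.toReal_nonneg
  -- The members of `D` that are not likely contribute at most `δ` each.
  have h1 : ∑ u ∈ D, (if ∏ j, valueProb P f (u j) ≤ δ then ∏ j, valueProb P f (u j) else 0)
      ≤ D.card * δ := by
    rw [← nsmul_eq_mul, ← Finset.sum_const]
    refine Finset.sum_le_sum fun u _ => ?_
    split_ifs with h
    · exact h
    · exact hδ
  refine le_trans ?_ (add_le_add le_rfl h1)
  have h2 : ∀ u : Fin k → Y,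
      (if ∏ j, valueProb P f (u j) ≤ δ then ∏ j, valueProb P f (u j) else 0) =
      ∑ s : Fin k → X, if (fun j => f (s j)) = u ∧ ∏ j, valueProb P f (f (s j)) ≤ δ
        then ∏ j, (P (s j)).toReal else 0 := by
    intro u
    split_ifs with h
    · rw [prod_valueProb]
      refine Finset.sum_congr rfl fun s _ => ?_
      refine if_congr ⟨fun hs => ⟨hs, ?_⟩, fun hs => hs.1⟩ rfl rfl
      subst hs
      exact h
    · refine (Finset.sum_eq_zero fun s _ => if_neg ?_).symm
      rintro ⟨rfl, h'⟩
      exact h h'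
  simp only [h2]
  rw [Finset.sum_comm, ← Finset.sum_add_distrib]
  refine Finset.sum_le_sum fun s _ => ?_
  have hnn : 0 ≤ ∑ u ∈ D, (if (fun j => f (s j)) = u ∧ ∏ j, valueProb P f (f (s j)) ≤ δ
        then ∏ j, (P (s j)).toReal else 0) :=
    Finset.sum_nonneg fun u _ => by split_ifs <;> first | exact hp s | exact le_rfl
  by_cases hD : (fun j => f (s j)) ∈ D
  · rw [if_pos hD]
    by_cases hl : (fun j => f (s j)) ∈ likelySeqs P f k δ
    · rw [if_pos hl]
      linarith
    · rw [if_neg hl, zero_add]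
      have hle : ∏ j, valueProb P f (f (s j)) ≤ δ := by
        by_contra h
        exact hl (Finset.mem_filter.2 ⟨by simp [Fintype.mem_piFinset], not_le.1 h⟩)
      refine le_trans ?_ (Finset.single_le_sum (fun u _ => ?_) hD)
      · rw [if_pos ⟨rfl, hle⟩]
      · split_ifs <;> first | exact hp s | exact le_rfl
  · rw [if_neg hD]
    refine add_nonneg ?_ hnn
    split_ifs <;> first | exact hp s | exact le_rfl

end Entropy

/-! ### Counting with linear maps -/

section Counting

theorem finite_linearMap (F A B : Type*) [Field F] [AddCommGroup A] [Module F A] [Finite A]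
    [AddCommGroup B] [Module F B] [Finite B] : Finite (A →ₗ[F] B) :=
  Finite.of_injective (fun T : A →ₗ[F] B => (T : A → B)) DFunLike.coe_injective

variable {F A B : Type*} [Field F] [AddCommGroup A] [Module F A] [AddCommGroup B] [Module F B]

/-- Rank-nullity, exponentiated. It turns ranks into probabilities: a uniformly random element of
`A` is killed by `T` with probability `|F| ^ (-rank)`. -/
theorem card_ker_mul_pow_finrank_range [Finite A] (T : A →ₗ[F] B) :
    Nat.card {x // T x = 0} * Nat.card F ^ Module.finrank F (LinearMap.range T) = Nat.card A := by
  have h1 : Nat.card {x // T x = 0} = Nat.card (LinearMap.ker T) := rfl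
  have : Module.Finite F A := Module.Finite.of_finite
  rw [h1, Module.natCard_eq_pow_finrank (K := F) (V := LinearMap.ker T),
    Module.natCard_eq_pow_finrank (K := F) (V := A), ← pow_add, add_comm,
    LinearMap.finrank_range_add_finrank_ker]

/-- Rescale a functional that does not vanish at `z`. Consequently a uniformly random linear map
sends a nonzero vector to a uniformly random one. -/
theorem exists_linearMap_apply_eq {z : A} (hz : z ≠ 0) (b : B) : ∃ T : A →ₗ[F] B, T z = b := by
  obtain ⟨φ, hφ⟩ := Module.Projective.exists_dual_ne_zero F hz
  exact ⟨φ.smulRight ((φ z)⁻¹ • b), by simp [smul_smul, hφ]⟩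

theorem finrank_range_of_surjective (T : A →ₗ[F] B) (hT : Function.Surjective T) :
    Module.finrank F (LinearMap.range T) = Module.finrank F B := by
  rw [LinearMap.range_eq_top.2 hT, finrank_top]

end Counting

/-! ### Linear schemes and the spread of a message -/

namespace FiniteFieldNetwork

open scoped Classical

variable {q K : ℕ} [Fact q.Prime] {V : Type*}

/-- The messages that are available at the node `v`; the others are replaced by zero. -/
noncomputable def hosted (N : FiniteFieldNetwork q K V) (m : ℕ) (v : V) :
    (Fin K → Fin m → ZMod q) →ₗ[ZMod q] (Fin K → Fin m → ZMod q) :=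
  LinearMap.pi fun i => if N.sender i = v then LinearMap.proj i else 0

theorem hosted_apply (N : FiniteFieldNetwork q K V) (m : ℕ) (v : V)
    (w : Fin K → Fin m → ZMod q) (i : Fin K) :
    N.hosted m v w i = if N.sender i = v then w i else 0 := by
  rw [hosted, LinearMap.pi_apply]
  split_ifs <;> rfl

theorem hosted_single_of_ne (N : FiniteFieldNetwork q K V) {m : ℕ} {i : Fin K} {v : V}
    (h : v ≠ N.sender i) (x : Fin m → ZMod q) : N.hosted m v (Pi.single i x) = 0 := by
  funext j
  rw [hosted_apply]
  split_ifs with hj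
  · rw [Pi.single_eq_of_ne]
    · rfl
    · rintro rfl
      exact h hj.symm
  · rfl

variable [Fintype V]

/-- `channelOutput` at the node `v` as a linear map. -/
noncomputable def channelMap (N : FiniteFieldNetwork q K V) (v : V) :
    (∀ u, Fin (N.inDim u) → ZMod q) →ₗ[ZMod q] (Fin (N.outDim v) → ZMod q) where
  toFun x := N.channelOutput x v
  map_add' x y := by
    simp only [channelOutput, ← Finset.sum_add_distrib]
    refine Finset.sum_congr rfl fun u _ => ?_
    split_ifs <;> simp [Matrix.mulVec_add]
  map_smul' a x := by
    simp only [channelOutput, Finset.smul_sum, RingHom.id_apply]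
    refine Finset.sum_congr rfl fun u _ => ?_
    split_ifs <;> simp [Matrix.mulVec_smul]

/-- The linear maps that the nodes apply in channel use `t` to the messages they host and to all
that they have received before, when every sender has a message of length `m`. -/
abbrev LinearStep (N : FiniteFieldNetwork q K V) (m t : ℕ) :=
  ∀ v : V, ((Fin K → Fin m → ZMod q) × (Fin t → Fin (N.outDim v) → ZMod q)) →ₗ[ZMod q]
    (Fin (N.inDim v) → ZMod q)

/-- The vectors received in the first `t` channel uses of a linear scheme, as a linear function of
the messages. -/
noncomputable def linReceived (N : FiniteFieldNetwork q K V) {m : ℕ} (E : ∀ t, N.LinearStep m t) :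
    ∀ (t : ℕ) (v : V),
      (Fin K → Fin m → ZMod q) →ₗ[ZMod q] (Fin t → Fin (N.outDim v) → ZMod q)
  | 0, _ => 0
  | t + 1, v => LinearMap.pi (Fin.snoc
      (α := fun _ => (Fin K → Fin m → ZMod q) →ₗ[ZMod q] (Fin (N.outDim v) → ZMod q))
      (fun τ => LinearMap.proj τ ∘ₗ linReceived N E t v)
      (N.channelMap v ∘ₗ LinearMap.pi fun u =>
        if u = N.receiver then 0
        else E t u ∘ₗ (N.hosted m u).prod (linReceived N E t u)))

theorem linReceived_succ (N : FiniteFieldNetwork q K V) {m : ℕ} (E : ∀ t, N.LinearStep m t)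
    (t : ℕ) (v : V) (w : Fin K → Fin m → ZMod q) :
    N.linReceived E (t + 1) v w =
      Fin.snoc (α := fun _ => Fin (N.outDim v) → ZMod q) (N.linReceived E t v w)
        (N.channelOutput (fun u => if u = N.receiver then 0
          else E t u (N.hosted m u w, N.linReceived E t u w)) v) := by
  funext τ
  rw [linReceived, LinearMap.pi_apply]
  refine Fin.lastCases ?_ (fun τ => ?_) τ
  · rw [Fin.snoc_last, Fin.snoc_last, LinearMap.comp_apply]
    change N.channelOutput _ v = _
    congr 1
    funext u
    rw [LinearMap.pi_apply]
    split_ifs <;> rfl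
  · rw [Fin.snoc_castSucc, Fin.snoc_castSucc]
    rfl

/-- Causality. It allows the steps to be chosen one after another without disturbing what was
received earlier. -/
theorem linReceived_congr (N : FiniteFieldNetwork q K V) {m : ℕ} {E E' : ∀ t, N.LinearStep m t}
    {t : ℕ} (h : ∀ τ < t, E τ = E' τ) : N.linReceived E t = N.linReceived E' t := by
  induction t with
  | zero => rfl
  | succ t ih =>
    funext v
    refine LinearMap.ext fun w => ?_
    rw [linReceived_succ, linReceived_succ, ih fun τ hτ => h τ (by omega), h t (by omega)]

/-- The nodes that know a nonzero linear image of the message `x` of sender `i` after `t` channel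
uses. -/
noncomputable def informed (N : FiniteFieldNetwork q K V) {m : ℕ} (E : ∀ t, N.LinearStep m t)
    (t : ℕ) (i : Fin K) (x : Fin m → ZMod q) : Finset V :=
  Finset.univ.filter fun v => v = N.sender i ∨ N.linReceived E t v (Pi.single i x) ≠ 0

theorem mem_informed {N : FiniteFieldNetwork q K V} {m : ℕ} {E : ∀ t, N.LinearStep m t}
    {t : ℕ} {i : Fin K} {x : Fin m → ZMod q} {v : V} :
    v ∈ N.informed E t i x ↔ v = N.sender i ∨ N.linReceived E t v (Pi.single i x) ≠ 0 := by
  simp [informed]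

theorem informed_congr (N : FiniteFieldNetwork q K V) {m : ℕ} {E E' : ∀ t, N.LinearStep m t}
    {t : ℕ} (h : ∀ τ < t, E τ = E' τ) : N.informed E t = N.informed E' t := by
  funext i x
  rw [informed, informed, N.linReceived_congr h]

theorem informed_subset_succ (N : FiniteFieldNetwork q K V) {m : ℕ} (E : ∀ t, N.LinearStep m t)
    (t : ℕ) (i : Fin K) (x : Fin m → ZMod q) :
    N.informed E t i x ⊆ N.informed E (t + 1) i x := by
  intro v hv
  rw [mem_informed] at hv ⊢
  refine hv.imp_right fun h h0 => h ?_
  rw [linReceived_succ] at h0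
  funext τ
  have := congrFun h0 τ.castSucc
  rwa [Fin.snoc_castSucc] at this

/-- Uninformed nodes transmit zero. -/
theorem signal_eq_zero_of_not_mem_informed (N : FiniteFieldNetwork q K V) {m : ℕ}
    (E : ∀ t, N.LinearStep m t) {t : ℕ} {i : Fin K} {x : Fin m → ZMod q} {u : V}
    (hu : u ∉ N.informed E t i x) :
    E t u (N.hosted m u (Pi.single i x), N.linReceived E t u (Pi.single i x)) = 0 := by
  rw [mem_informed, not_or, not_not] at hu
  rw [N.hosted_single_of_ne hu.1, hu.2, Prod.mk_zero_zero, map_zero]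

/-- A nonzero signal can only arrive along an edge from an informed node. This is needed because a
cut of `G({i})` may contain only nodes reachable from sender `i`. -/
theorem reachable_of_mem_informed (N : FiniteFieldNetwork q K V) {m : ℕ}
    (E : ∀ t, N.LinearStep m t) {t : ℕ} {i : Fin K} {x : Fin m → ZMod q} {v : V}
    (hv : v ∈ N.informed E t i x) : v ∈ N.reachable {i} := by
  induction t generalizing v with
  | zero =>
    rw [mem_informed] at hv
    rcases hv with rfl | h
    · exact ⟨i, rfl, .refl⟩
    · exact absurd rfl h
  | succ t ih =>
    by_cases hvt : v ∈ N.informed E t i x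
    · exact ih hvt
    rw [mem_informed] at hv
    rcases hv with rfl | h
    · exact ⟨i, rfl, .refl⟩
    by_contra hr
    apply h
    rw [mem_informed, not_or, not_not] at hvt
    have h0 : N.channelOutput (fun u => if u = N.receiver then 0
        else E t u (N.hosted m u (Pi.single i x), N.linReceived E t u (Pi.single i x))) v = 0 := by
      refine Finset.sum_eq_zero fun u _ => ?_
      by_cases h1 : N.graph.Adj u v
      · have hu : u ∉ N.informed E t i x := fun hu =>
          have ⟨j, hj, hpath⟩ := ih hu
          hr ⟨j, hj, hpath.tail h1⟩
        rw [if_pos h1]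
        beta_reduce
        rw [N.signal_eq_zero_of_not_mem_informed E hu, ite_self, Matrix.mulVec_zero]
      · rw [if_neg h1]
    rw [linReceived_succ, hvt.2, h0]
    funext τ
    refine Fin.lastCases ?_ (fun τ => ?_) τ
    · rw [Fin.snoc_last]; rfl
    · rw [Fin.snoc_castSucc]; rfl

theorem isCut_informed (N : FiniteFieldNetwork q K V) {m : ℕ} (E : ∀ t, N.LinearStep m t)
    {t : ℕ} {i : Fin K} {x : Fin m → ZMod q} (h : N.receiver ∉ N.informed E t i x) :
    N.IsCut {i} (N.informed E t i x) := by
  refine ⟨fun v hv => N.reachable_of_mem_informed E hv, ?_, h⟩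
  rintro j rfl
  exact mem_informed.2 (Or.inl rfl)

instance (N : FiniteFieldNetwork q K V) (m t : ℕ) : Finite (N.LinearStep m t) :=
  @Pi.finite _ _ _ fun _ => finite_linearMap _ _ _

/-- A random linear step leaves the set `Ω` of informed nodes unchanged with probability at most
`q ^ (-rank)`. -/
theorem card_informed_eq_mul_le (N : FiniteFieldNetwork q K V) {m : ℕ}
    (E : ∀ t, N.LinearStep m t) (t : ℕ) (i : Fin K) {x : Fin m → ZMod q} (hx : x ≠ 0)
    (hd : N.receiver ∉ N.informed E t i x) :
    Nat.card {S : N.LinearStep m t //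
      N.informed (Function.update E t S) (t + 1) i x = N.informed E t i x} *
        q ^ (N.transferMatrix {i} (N.informed E t i x)).rank ≤ Nat.card (N.LinearStep m t) := by
  set Ω := N.informed E t i x with hΩ
  set w : Fin K → Fin m → ZMod q := Pi.single i x with hw
  set H := N.transferMatrix {i} Ω
  let z : ∀ u, (Fin K → Fin m → ZMod q) × (Fin t → Fin (N.outDim u) → ZMod q) :=
    fun u => (N.hosted m u w, N.linReceived E t u w)
  have hz : ∀ u ∈ Ω, z u ≠ 0 := by
    intro u hu h0
    rw [hΩ, mem_informed] at hu
    rcases hu with rfl | hu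
    · have := congrFun (congrArg Prod.fst h0) i
      simp only [z, hosted_apply, hw, if_true, Pi.single_eq_same] at this
      exact hx this
    · exact hu (congrArg Prod.snd h0)
  -- `T S` lists the signals of the nodes in `Ω`. It is surjective because each such node knows a
  -- nonzero vector and the nodes choose their maps independently.
  let T : N.LinearStep m t →ₗ[ZMod q] (((u : {u : V // u ∈ Ω}) × Fin (N.inDim u.1)) → ZMod q) :=
    { toFun := fun S a => S a.1.1 (z a.1.1) a.2
      map_add' := fun _ _ => rfl
      map_smul' := fun _ _ => rfl }
  have hT : Function.Surjective T := by
    intro y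
    have h1 : ∀ u : V, ∃ S : ((Fin K → Fin m → ZMod q) × (Fin t → Fin (N.outDim u) → ZMod q))
        →ₗ[ZMod q] (Fin (N.inDim u) → ZMod q), ∀ hu : u ∈ Ω, S (z u) = fun j => y ⟨⟨u, hu⟩, j⟩ := by
      intro u
      by_cases hu : u ∈ Ω
      · obtain ⟨S, hS⟩ := exists_linearMap_apply_eq (F := ZMod q) (hz u hu)
          (fun j => y ⟨⟨u, hu⟩, j⟩)
        exact ⟨S, fun _ => hS⟩
      · exact ⟨0, fun h => absurd h hu⟩
    choose S hS using h1
    refine ⟨S, ?_⟩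
    funext a
    exact congrFun (hS a.1.1 a.1.2) a.2
  have hrank : Module.finrank (ZMod q) (LinearMap.range (H.mulVecLin ∘ₗ T)) = H.rank := by
    rw [LinearMap.range_comp_of_range_eq_top _ (LinearMap.range_eq_top.2 hT)]
    rfl
  have hcount := card_ker_mul_pow_finrank_range (H.mulVecLin ∘ₗ T)
  rw [hrank, Nat.card_zmod] at hcount
  rw [← hcount]
  refine Nat.mul_le_mul_right _ (Nat.card_le_card_of_injective
    (Subtype.map id fun S hS => ?_) (Subtype.map_injective _ Function.injective_id))
  -- If no node becomes informed, every reachable node outside `Ω` receives zero, and only `Ω`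
  -- transmits.
  change H.mulVec (T S) = 0
  funext b
  obtain ⟨⟨v, hvr, hvΩ⟩, row⟩ := b
  have hcongr : ∀ τ < t, Function.update E t S τ = E τ := fun τ hτ =>
    Function.update_of_ne hτ.ne _ _
  have hv : v ∉ N.informed (Function.update E t S) (t + 1) i x := by
    have hS' : N.informed (Function.update E t S) (t + 1) i x = Ω := hS
    rwa [hS']
  rw [mem_informed, not_or, not_not, linReceived_succ, N.linReceived_congr hcongr] at hv
  have h0 := congrFun (congrFun hv.2 (Fin.last t)) row
  rw [Fin.snoc_last, Function.update_self] at h0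
  refine Eq.trans ?_ h0
  simp only [channelOutput, Finset.sum_apply, Matrix.mulVec, dotProduct, Fintype.sum_sigma]
  rw [← Finset.sum_subset (Finset.subset_univ Ω), ← Finset.sum_coe_sort Ω]
  · refine Finset.sum_congr rfl fun u _ => ?_
    have hur : u.1 ≠ N.receiver := by
      intro h
      exact hd (h ▸ u.2)
    rw [if_neg hur]
    simp only [H, transferMatrix, Matrix.of_apply]
    split_ifs
    · rfl
    · simp
  · intro u _ hu
    have := N.signal_eq_zero_of_not_mem_informed (Function.update E t S) (t := t) (i := i) (x := x)
      (u := u) (by rwa [N.informed_congr hcongr])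
    rw [Function.update_self, N.linReceived_congr hcongr] at this
    simp only [← hw] at this ⊢
    simp [this]

end FiniteFieldNetwork

/-! ### Failure potential and derandomization -/

/-- A bound on the probability that the receiver stays uninformed when `s` channel uses are left
and `c` nodes are uninformed, where `a⁻¹` bounds the probability that no node becomes informed in
a channel use. -/
noncomputable def failBound (a : ℝ) (s c : ℕ) : ℝ := ((s + 1) * a) ^ c / a ^ s

theorem failBound_nonneg {a : ℝ} (ha : 1 ≤ a) (s c : ℕ) : 0 ≤ failBound a s c := by
  have : 0 ≤ a := by linarith
  unfold failBound
  positivity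

theorem failBound_mono {a : ℝ} (ha : 1 ≤ a) (s : ℕ) {c c' : ℕ} (h : c ≤ c') :
    failBound a s c ≤ failBound a s c' := by
  unfold failBound
  have h1 : 1 ≤ ((s : ℝ) + 1) * a := by
    have : (0 : ℝ) ≤ s := s.cast_nonneg
    nlinarith
  gcongr

/-- The recursion for one channel use: stuck with weight `a⁻¹`, or at least one node gained. After
removing the common factor it reads `(s + 2) * (s + 1) ^ c ≤ (s + 2) ^ (c + 1)`, which is why the
polynomial factor is `(s + 1) ^ c`. -/
theorem failBound_succ {a : ℝ} (ha : 1 ≤ a) (s c : ℕ) :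
    a⁻¹ * failBound a s (c + 1) + failBound a s c ≤ failBound a (s + 1) (c + 1) := by
  have ha0 : 0 < a := by linarith
  have h1 : a⁻¹ * failBound a s (c + 1) + failBound a s c =
      a ^ (c + 1) / a ^ (s + 1) * (((s : ℝ) + 2) * ((s : ℝ) + 1) ^ c) := by
    unfold failBound
    rw [mul_pow, mul_pow]
    field_simp
    ring
  have h2 : failBound a (s + 1) (c + 1) = a ^ (c + 1) / a ^ (s + 1) * ((s : ℝ) + 2) ^ (c + 1) := by
    unfold failBound
    rw [mul_pow]
    push_cast
    ring
  rw [h1, h2, pow_succ' ((s : ℝ) + 2)]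
  gcongr
  norm_num

namespace FiniteFieldNetwork

open scoped Classical

variable {q K : ℕ} [Fact q.Prime] {V : Type*} [Fintype V]

/-- The bound on the conditional failure probability for the message `x` of sender `i` after `t`
channel uses, when `s` are left. -/
noncomputable def failPotential (N : FiniteFieldNetwork q K V) {m : ℕ} (r : ℕ)
    (E : ∀ t, N.LinearStep m t) (t s : ℕ) (i : Fin K) (x : Fin m → ZMod q) : ℝ :=
  if N.receiver ∈ N.informed E t i x then 0
  else failBound ((q : ℝ) ^ r) s (Fintype.card V - (N.informed E t i x).card)

theorem one_le_cast_pow (q r : ℕ) [Fact q.Prime] : (1 : ℝ) ≤ (q : ℝ) ^ r :=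
  one_le_pow₀ (by exact_mod_cast (Fact.out : q.Prime).one_lt.le)

/-- The potential is a supermartingale under a uniformly random step: the informed set is a cut, so
it stalls with probability at most `q ^ (-r)`, and `failBound_succ` absorbs both outcomes. -/
theorem sum_failPotential_le (N : FiniteFieldNetwork q K V) {m r : ℕ} (E : ∀ t, N.LinearStep m t)
    (t s : ℕ) [Fintype (N.LinearStep m t)] (i : Fin K) (hr : r ≤ N.minCutRank {i})
    {x : Fin m → ZMod q} (hx : x ≠ 0) :
    ∑ S : N.LinearStep m t, N.failPotential r (Function.update E t S) (t + 1) s i x ≤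
      ∑ _S : N.LinearStep m t, N.failPotential r E t (s + 1) i x := by
  have ha := one_le_cast_pow q r
  set a := (q : ℝ) ^ r with haq
  have hsub : ∀ S, N.informed E t i x ⊆ N.informed (Function.update E t S) (t + 1) i x := by
    intro S
    have := N.informed_subset_succ (Function.update E t S) t i x
    rwa [N.informed_congr (E' := E) fun τ hτ => Function.update_of_ne hτ.ne _ _] at this
  by_cases hd : N.receiver ∈ N.informed E t i x
  · refine Finset.sum_le_sum fun S _ => ?_
    rw [failPotential, failPotential, if_pos hd, if_pos (hsub S hd)]
  have hcard : (N.informed E t i x).card < Fintype.card V :=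
    Finset.card_lt_univ_of_notMem hd
  obtain ⟨c, hc⟩ : ∃ c, Fintype.card V - (N.informed E t i x).card = c + 1 :=
    ⟨Fintype.card V - (N.informed E t i x).card - 1, by omega⟩
  have h1 : ∀ S : N.LinearStep m t, N.failPotential r (Function.update E t S) (t + 1) s i x ≤
      (if N.informed (Function.update E t S) (t + 1) i x = N.informed E t i x then
        failBound a s (c + 1) else 0) + failBound a s c := by
    intro S
    have hn := failBound_nonneg ha s c
    have hn' := failBound_nonneg ha s (c + 1)
    unfold failPotential
    split_ifs with h2 h3 h3
    · linarith
    · linarith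
    · rw [h3, hc]
      linarith
    · rw [zero_add]
      refine failBound_mono ha s ?_
      have := Finset.card_lt_card ((hsub S).ssubset_of_ne (Ne.symm h3))
      omega
  refine (Finset.sum_le_sum fun S _ => h1 S).trans ?_
  rw [Finset.sum_add_distrib, ← Finset.sum_filter, Finset.sum_const, Finset.sum_const,
    Finset.sum_const, nsmul_eq_mul, nsmul_eq_mul, nsmul_eq_mul, failPotential, if_neg hd, hc]
  have hcount := N.card_informed_eq_mul_le E t i hx hd
  rw [Nat.card_eq_fintype_card, Nat.card_eq_fintype_card, Fintype.card_subtype] at hcount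
  have hrank : r ≤ (N.transferMatrix {i} (N.informed E t i x)).rank :=
    hr.trans (Nat.sInf_le ⟨_, N.isCut_informed E hd, rfl⟩)
  have hcount' := (Nat.mul_le_mul_left _ (Nat.pow_le_pow_right
    (Fact.out : q.Prime).pos hrank)).trans hcount
  set M := (Finset.univ.filter fun S : N.LinearStep m t =>
    N.informed (Function.update E t S) (t + 1) i x = N.informed E t i x).card
  have hM : (M : ℝ) * a ≤ Fintype.card (N.LinearStep m t) := by
    rw [haq]
    exact_mod_cast hcount'
  have ha0 : 0 < a := by linarith
  have hM' : (M : ℝ) ≤ Fintype.card (N.LinearStep m t) * a⁻¹ := by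
    rwa [← div_eq_mul_inv, le_div_iff₀ ha0]
  rw [Finset.card_univ]
  calc (M : ℝ) * failBound a s (c + 1) + Fintype.card (N.LinearStep m t) * failBound a s c
      ≤ Fintype.card (N.LinearStep m t) * a⁻¹ * failBound a s (c + 1)
          + Fintype.card (N.LinearStep m t) * failBound a s c := by
        gcongr
        exact failBound_nonneg ha _ _
    _ = Fintype.card (N.LinearStep m t) *
          (a⁻¹ * failBound a s (c + 1) + failBound a s c) := by ring
    _ ≤ _ := by
        gcongr
        exact failBound_succ ha s c

/-- If `m` is slightly less than `n * r`, there is a linear scheme with which the receiver can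
recover a message of length `m` of any single sender when the others are silent. -/
theorem exists_linearSteps (N : FiniteFieldNetwork q K V) {m n r : ℕ}
    (hr : ∀ i, r ≤ N.minCutRank {i})
    (hm : (K : ℝ) * q ^ m * failBound ((q : ℝ) ^ r) n (Fintype.card V) < 1) :
    ∃ E : ∀ t, N.LinearStep m t, ∀ (i : Fin K) (x : Fin m → ZMod q),
      N.linReceived E n N.receiver (Pi.single i x) = 0 → x = 0 := by
  have ha := one_le_cast_pow q r
  let Z : Finset (Fin K × (Fin m → ZMod q)) := Finset.univ.filter fun z => z.2 ≠ 0
  have main : ∀ t ≤ n, ∃ E : ∀ t, N.LinearStep m t,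
      ∑ z ∈ Z, N.failPotential r E t (n - t) z.1 z.2 < 1 := by
    intro t
    induction t with
    | zero =>
      intro _
      -- The zero steps are placeholders; those before `n` are overwritten in turn.
      refine ⟨fun t v => 0, lt_of_le_of_lt ?_ hm⟩
      have h1 : ∀ z ∈ Z, N.failPotential r (fun t v => 0) 0 (n - 0) z.1 z.2 ≤
          failBound ((q : ℝ) ^ r) n (Fintype.card V) := by
        intro z _
        unfold failPotential
        split_ifs
        · exact failBound_nonneg ha _ _
        · exact failBound_mono ha _ (Nat.sub_le _ _)
      refine (Finset.sum_le_card_nsmul _ _ _ h1).trans ?_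
      rw [nsmul_eq_mul]
      gcongr
      · exact failBound_nonneg ha _ _
      · have : Z.card ≤ K * q ^ m := by
          refine (Finset.card_le_univ _).trans_eq ?_
          simp [ZMod.card]
        exact_mod_cast this
    | succ t ih =>
      intro ht
      obtain ⟨E, hE⟩ := ih (by omega)
      have := Fintype.ofFinite (N.LinearStep m t)
      have hns : n - t = (n - (t + 1)) + 1 := by omega
      have hle : ∑ S : N.LinearStep m t, ∑ z ∈ Z,
          N.failPotential r (Function.update E t S) (t + 1) (n - (t + 1)) z.1 z.2 ≤
          ∑ _S : N.LinearStep m t, ∑ z ∈ Z, N.failPotential r E t (n - t) z.1 z.2 := by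
        rw [Finset.sum_comm, Finset.sum_comm (t := Z), hns]
        exact Finset.sum_le_sum fun z hz =>
          N.sum_failPotential_le E t _ z.1 (hr z.1) (Finset.mem_filter.1 hz).2
      -- Method of conditional expectations: some step does no worse than the average.
      obtain ⟨S, _, hS⟩ := Finset.exists_le_of_sum_le ⟨0, Finset.mem_univ _⟩ hle
      exact ⟨_, hS.trans_lt hE⟩
  obtain ⟨E, hE⟩ := main n le_rfl
  refine ⟨E, fun i x h0 => ?_⟩
  by_contra hx
  have hd : N.receiver ∉ N.informed E n i x := by
    rw [mem_informed, not_or, not_not]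
    exact ⟨(N.sender_ne_receiver i).symm, h0⟩
  have hle := Finset.single_le_sum (f := fun z : Fin K × (Fin m → ZMod q) =>
    N.failPotential r E n (n - n) z.1 z.2) (fun z _ => by
      unfold failPotential
      split_ifs
      · exact le_rfl
      · exact failBound_nonneg ha _ _) (show (i, x) ∈ Z from by simp [Z, hx])
  -- With no channel use left a single failure already costs at least `1`, while the total is below
  -- `1`.
  have h1 : 1 ≤ N.failPotential r E n (n - n) i x := by
    rw [failPotential, if_neg hd, failBound]
    simp only [Nat.sub_self, pow_zero, div_one, Nat.cast_zero, zero_add, one_mul]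
    exact one_le_pow₀ ha
  linarith

end FiniteFieldNetwork

/-! ### A common receiver map -/

section Counting

variable {F : Type*} [Field F] [Finite F]

/-- Over a finite field, finitely many injective linear maps can be followed by a common linear
map that makes all of them surjective. -/
theorem exists_common_surjective {ι B : Type*} [Fintype ι] [AddCommGroup B] [Module F B] [Finite B]
    {m m' : ℕ} (T : ι → (Fin m → F) →ₗ[F] B) (hT : ∀ i, Function.Injective (T i))
    (h : Fintype.card ι * Nat.card F ^ m' < Nat.card F ^ m) :
    ∃ D : B →ₗ[F] (Fin m' → F), ∀ i, Function.Surjective (D ∘ₗ T i) := by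
  classical
  have hfin := finite_linearMap F B (Fin m' → F)
  have hfin' : Finite (Module.Dual F (Fin m' → F)) := finite_linearMap F _ _
  have := Fintype.ofFinite (B →ₗ[F] (Fin m' → F))
  have := Fintype.ofFinite (Module.Dual F (Fin m' → F))
  by_contra! hD
  let bad : ι × Module.Dual F (Fin m' → F) → Finset (B →ₗ[F] (Fin m' → F)) := fun z =>
    Finset.univ.filter fun D => z.2 ∘ₗ D ∘ₗ T z.1 = 0
  let Z : Finset (ι × Module.Dual F (Fin m' → F)) := Finset.univ.filter fun z => z.2 ≠ 0
  -- For fixed `i` and `φ ≠ 0` the functional `φ ∘ D ∘ T i` is uniform on the dual of `F ^ m` when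
  -- `D` is uniform, so it vanishes with probability exactly `|F| ^ (-m)`.
  have hbad : ∀ z ∈ Z, (bad z).card * Nat.card F ^ m = Nat.card (B →ₗ[F] (Fin m' → F)) := by
    rintro ⟨i, φ⟩ hz
    have hφ : φ ≠ 0 := (Finset.mem_filter.1 hz).2
    let L : (B →ₗ[F] (Fin m' → F)) →ₗ[F] Module.Dual F (Fin m → F) :=
      { toFun := fun D => φ ∘ₗ D ∘ₗ T i
        map_add' := fun D D' => LinearMap.ext fun x => by simp
        map_smul' := fun a D => LinearMap.ext fun x => by simp }
    have hL : Function.Surjective L := by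
      intro ψ
      obtain ⟨R, hR⟩ := (T i).exists_leftInverse_of_injective (LinearMap.ker_eq_bot.2 (hT i))
      obtain ⟨e, he⟩ : ∃ e, φ e ≠ 0 := by
        by_contra! h0
        exact hφ (LinearMap.ext h0)
      refine ⟨(ψ ∘ₗ R).smulRight ((φ e)⁻¹ • e), LinearMap.ext fun x => ?_⟩
      have hRx : R (T i x) = x := LinearMap.congr_fun hR x
      change φ (ψ (R (T i x)) • (φ e)⁻¹ • e) = ψ x
      rw [hRx, map_smul, map_smul, smul_eq_mul, smul_eq_mul, inv_mul_cancel₀ he, mul_one]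
    have hc := card_ker_mul_pow_finrank_range L
    rw [finrank_range_of_surjective L hL, Subspace.dual_finrank_eq, Module.finrank_fin_fun,
      Nat.card_eq_fintype_card, Fintype.card_subtype] at hc
    exact hc
  -- A range that is not everything is annihilated by a nonzero functional, so failure of
  -- surjectivity is covered by a union bound over functionals.
  have hcover : (Finset.univ : Finset (B →ₗ[F] (Fin m' → F))) ⊆ Z.biUnion bad := by
    intro D _
    obtain ⟨i, hi⟩ := hD D
    have hlt : LinearMap.range (D ∘ₗ T i) < ⊤ :=
      lt_top_iff_ne_top.2 fun h0 => hi (LinearMap.range_eq_top.1 h0)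
    obtain ⟨φ, hφ, hle⟩ := Submodule.exists_le_ker_of_lt_top _ hlt
    refine Finset.mem_biUnion.2 ⟨(i, φ), by simp [Z, hφ], ?_⟩
    simp only [bad, Finset.mem_filter, Finset.mem_univ, true_and]
    exact LinearMap.ext fun x => hle (LinearMap.mem_range_self _ x)
  have hZ : Z.card ≤ Fintype.card ι * Nat.card F ^ m' := by
    refine (Finset.card_le_univ _).trans_eq ?_
    rw [Fintype.card_prod, ← Nat.card_eq_fintype_card (α := Module.Dual F (Fin m' → F)),
      Module.natCard_eq_pow_finrank (K := F), Subspace.dual_finrank_eq, Module.finrank_fin_fun]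
  have h1 := (Finset.card_le_card hcover).trans Finset.card_biUnion_le
  have h2 := Nat.mul_le_mul_right (Nat.card F ^ m) h1
  rw [Finset.sum_mul, Finset.sum_congr rfl hbad, Finset.sum_const, smul_eq_mul, Finset.card_univ,
    ← Nat.card_eq_fintype_card, mul_comm] at h2
  have hpos : 0 < Nat.card (B →ₗ[F] (Fin m' → F)) := Nat.card_pos
  have h3 := Nat.le_of_mul_le_mul_right (h2.trans (Nat.mul_le_mul_right _ hZ)) hpos
  omega

/-- The fraction of linear maps to `F ^ m` that kill a given nonzero vector. -/
theorem card_apply_eq_zero_mul {A : Type*} [AddCommGroup A] [Module F A] [Finite A] {m : ℕ}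
    {z : A} (hz : z ≠ 0) :
    Nat.card {B : A →ₗ[F] (Fin m → F) // B z = 0} * Nat.card F ^ m
      = Nat.card (A →ₗ[F] (Fin m → F)) := by
  have := finite_linearMap F A (Fin m → F)
  have h := card_ker_mul_pow_finrank_range
    ((LinearMap.applyₗ z : (A →ₗ[F] (Fin m → F)) →ₗ[F] (Fin m → F)))
  rw [finrank_range_of_surjective _ fun b => exists_linearMap_apply_eq hz b,
    Module.finrank_fin_fun] at h
  exact h

end Counting

/-! ### Random linear hashing -/

section Hashing

open scoped Classical

variable {F : Type*} [Field F] [Finite F]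

/-- Random linear hashing: some linear map to `F ^ m` separates a random vector `U` from the other
elements of a finite set `T` with probability at least `1 - |T| / |F| ^ m`. -/
theorem exists_linear_hash {S A : Type*} [Fintype S] [AddCommGroup A] [Module F A] [Finite A]
    (m : ℕ) (μ : S → ℝ) (hμ : ∀ s, 0 ≤ μ s) (hμ1 : ∑ s, μ s = 1) (U : S → A) (T : Finset A) :
    ∃ B : A →ₗ[F] (Fin m → F),
      ∑ s, (if ∃ a ∈ T, a ≠ U s ∧ B a = B (U s) then μ s else 0) ≤
        T.card / (Nat.card F : ℝ) ^ m := by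
  have := finite_linearMap F A (Fin m → F)
  have := Fintype.ofFinite (A →ₗ[F] (Fin m → F))
  have hF : (0 : ℝ) < (Nat.card F : ℝ) ^ m := pow_pos (by exact_mod_cast Nat.card_pos) m
  suffices h : ∑ B : A →ₗ[F] (Fin m → F),
      ∑ s, (if ∃ a ∈ T, a ≠ U s ∧ B a = B (U s) then μ s else 0) ≤
        ∑ _B : A →ₗ[F] (Fin m → F), T.card / (Nat.card F : ℝ) ^ m by
    obtain ⟨B, _, hB⟩ := Finset.exists_le_of_sum_le ⟨0, Finset.mem_univ _⟩ h
    exact ⟨B, hB⟩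
  rw [Finset.sum_comm]
  have h1 : ∀ s, ∑ B : A →ₗ[F] (Fin m → F),
      (if ∃ a ∈ T, a ≠ U s ∧ B a = B (U s) then μ s else 0) ≤
      μ s * ∑ _B : A →ₗ[F] (Fin m → F), T.card / (Nat.card F : ℝ) ^ m := by
    intro s
    rw [← Finset.sum_filter, Finset.sum_const, nsmul_eq_mul, mul_comm]
    refine mul_le_mul_of_nonneg_left ?_ (hμ s)
    -- By linearity a collision means that `B` kills the nonzero vector `a - U s`.
    have hsub : (Finset.univ.filter fun B : A →ₗ[F] (Fin m → F) =>
        ∃ a ∈ T, a ≠ U s ∧ B a = B (U s)) ⊆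
        (T.filter fun a => a ≠ U s).biUnion fun a => Finset.univ.filter fun B => B (a - U s) = 0 := by
      intro B hB
      obtain ⟨a, haT, hne, haB⟩ := (Finset.mem_filter.1 hB).2
      exact Finset.mem_biUnion.2 ⟨a, Finset.mem_filter.2 ⟨haT, hne⟩,
        Finset.mem_filter.2 ⟨Finset.mem_univ _, by rw [map_sub, haB, sub_self]⟩⟩
    have h2 := (Finset.card_le_card hsub).trans Finset.card_biUnion_le
    have h3 : ∀ a ∈ T.filter fun a => a ≠ U s,
        ((Finset.univ.filter fun B : A →ₗ[F] (Fin m → F) => B (a - U s) = 0).card : ℝ) =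
          Fintype.card (A →ₗ[F] (Fin m → F)) / (Nat.card F : ℝ) ^ m := by
      intro a ha
      have := card_apply_eq_zero_mul (F := F) (m := m) (sub_ne_zero.2 (Finset.mem_filter.1 ha).2)
      rw [Nat.card_eq_fintype_card, Fintype.card_subtype,
        Nat.card_eq_fintype_card (α := A →ₗ[F] (Fin m → F))] at this
      rw [eq_div_iff hF.ne']
      exact_mod_cast this
    have h4 : ((Finset.univ.filter fun B : A →ₗ[F] (Fin m → F) =>
        ∃ a ∈ T, a ≠ U s ∧ B a = B (U s)).card : ℝ) ≤ ∑ a ∈ T.filter fun a => a ≠ U s,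
        ((Finset.univ.filter fun B : A →ₗ[F] (Fin m → F) => B (a - U s) = 0).card : ℝ) := by
      exact_mod_cast h2
    rw [Finset.sum_congr rfl h3, Finset.sum_const, nsmul_eq_mul] at h4
    refine h4.trans ?_
    rw [Finset.sum_const, nsmul_eq_mul, Finset.card_univ, mul_div_assoc', mul_div_assoc',
      mul_comm (Fintype.card _ : ℝ)]
    gcongr
    exact Finset.filter_subset _ _
  refine (Finset.sum_le_sum fun s _ => h1 s).trans_eq ?_
  rw [← Finset.sum_mul, hμ1, one_mul]

end Hashing

/-! ### Block codes from linear schemes -/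

namespace FiniteFieldNetwork

open scoped Classical

variable {q K p : ℕ} [Fact q.Prime] {V : Type*} [Fintype V]

/-- The block code of a linear scheme: sender `i` hashes its transformed source block with `B`,
encodes the result with `C i`, and the receiver applies `D` and decodes with `dec`. -/
noncomputable def linearCode (N : FiniteFieldNetwork q K V) {Y : Type*} {L k n m m' : ℕ}
    (E : ∀ t, N.LinearStep m t) (g : Fin K → Fin p → Fin L → ZMod q)
    (B : (Fin k → Fin L → ZMod q) →ₗ[ZMod q] (Fin m' → ZMod q))
    (C : Fin K → (Fin m' → ZMod q) →ₗ[ZMod q] (Fin m → ZMod q))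
    (D : (Fin n → Fin (N.outDim N.receiver) → ZMod q) →ₗ[ZMod q] (Fin m' → ZMod q))
    (dec : (Fin m' → ZMod q) → Fin k → Y) : N.BlockCode p Y k n where
  encode v t src hist := E t v
    (fun i => if h : N.sender i = v then C i (B fun j => g i (src ⟨i, h⟩ j)) else 0, hist)
  decode j y := dec (D y) j

theorem linearCode_received (N : FiniteFieldNetwork q K V) {Y : Type*} {L k n m m' : ℕ}
    (E : ∀ t, N.LinearStep m t) (g : Fin K → Fin p → Fin L → ZMod q)
    (B : (Fin k → Fin L → ZMod q) →ₗ[ZMod q] (Fin m' → ZMod q))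
    (C : Fin K → (Fin m' → ZMod q) →ₗ[ZMod q] (Fin m → ZMod q))
    (D : (Fin n → Fin (N.outDim N.receiver) → ZMod q) →ₗ[ZMod q] (Fin m' → ZMod q))
    (dec : (Fin m' → ZMod q) → Fin k → Y) (s : Fin k → Fin K → Fin p) (t : ℕ) (v : V) :
    (N.linearCode E g B C D dec).received s t v =
      N.linReceived E t v fun i => C i (B fun j => g i (s j i)) := by
  induction t generalizing v with
  | zero =>
    funext τ
    exact τ.elim0
  | succ t ih =>
    rw [BlockCode.received, linReceived_succ, ih]
    congr 2
    funext u
    split_ifs with hu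
    · rfl
    · change E t u (_, _) = _
      rw [ih]
      congr 2
      funext i
      rw [hosted_apply]
      split_ifs <;> rfl

/-- The residues modulo `q` of the entries of a sequence of vectors. -/
def residues (q : ℕ) {L k : ℕ} (u : Fin k → Fin L → ℕ) : Fin k → Fin L → ZMod q :=
  fun j l => (u j l : ZMod q)

/-- A linear scheme with a common linear hash of all sources yields a block code whose errors come
from unlikely value sequences and from hash collisions. -/
theorem exists_code (N : FiniteFieldNetwork q K V) (P : PMF (Fin K → Fin p)) {L : ℕ}
    (f : (Fin K → Fin p) → Fin L → ℕ) (g : Fin K → Fin p → Fin L → ZMod q)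
    (hfg : ∀ s l, (f s l : ZMod q) = ∑ i, g i (s i) l)
    (hinj : ∀ s s', (∀ l, (f s l : ZMod q) = f s' l) → f s = f s')
    {m m' n r : ℕ} (hr : ∀ i, r ≤ N.minCutRank {i})
    (hm : (K : ℝ) * q ^ m * failBound ((q : ℝ) ^ r) n (Fintype.card V) < 1)
    (hm' : K * q ^ m' < q ^ m) (k : ℕ) (δ : ℝ) :
    ∃ c : N.BlockCode p (Fin L → ℕ) k n, c.errorProb P f ≤
      (∑ s : Fin k → Fin K → Fin p, (if (fun j => f (s j)) ∉ likelySeqs P f k δ then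
          ∏ j, (P (s j)).toReal else 0)) + (likelySeqs P f k δ).card / (q : ℝ) ^ m' := by
  obtain ⟨E, hE⟩ := N.exists_linearSteps hr hm
  let A : Fin K → (Fin m → ZMod q) →ₗ[ZMod q] (Fin n → Fin (N.outDim N.receiver) → ZMod q) :=
    fun i => N.linReceived E n N.receiver ∘ₗ LinearMap.single (ZMod q) (fun _ => Fin m → ZMod q) i
  have hA : ∀ i, Function.Injective (A i) := fun i =>
    (injective_iff_map_eq_zero (A i)).2 fun x hx => hE i x hx
  obtain ⟨D, hD⟩ := exists_common_surjective (m' := m') A hA (by simpa using hm')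
  -- Precoding by `C i` makes the path from sender `i` to the output of `D` the identity, so these
  -- outputs add up without distortion.
  choose C hC using fun i => (D ∘ₗ A i).exists_rightInverse_of_surjective
    (LinearMap.range_eq_top.2 (hD i))
  set T := likelySeqs P f k δ
  have hp : ∀ s : Fin k → Fin K → Fin p, 0 ≤ ∏ j, (P (s j)).toReal := fun s =>
    Finset.prod_nonneg fun j _ => ENNReal.toReal_nonneg
  obtain ⟨B, hB⟩ := exists_linear_hash (F := ZMod q) m'
    (fun s : Fin k → Fin K → Fin p => ∏ j, (P (s j)).toReal) hp (sum_prod_toReal_pmf P k)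
    (fun s => residues q fun j => f (s j)) (T.image (residues q))
  -- Any likely sequence with the right hash is chosen; the default value zero plays no role when
  -- the true sequence is likely.
  let dec : (Fin m' → ZMod q) → Fin k → Fin L → ℕ := fun b =>
    if h : ∃ u ∈ T, B (residues q u) = b then h.choose else fun _ _ => 0
  have hrecv : ∀ s, D ((N.linearCode E g B C D dec).received s n N.receiver) =
      B (residues q fun j => f (s j)) := by
    intro s
    rw [linearCode_received]
    have h1 : N.linReceived E n N.receiver (fun i => C i (B fun j => g i (s j i))) =
        ∑ i, A i (C i (B fun j => g i (s j i))) := by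
      conv_lhs => rw [← Finset.univ_sum_single (fun i => C i (B fun j => g i (s j i)))]
      rw [map_sum]
      rfl
    rw [h1, map_sum]
    have h2 : ∀ i, D (A i (C i (B fun j => g i (s j i)))) = B fun j => g i (s j i) :=
      fun i => LinearMap.congr_fun (hC i) _
    simp only [h2]
    rw [← map_sum]
    congr 1
    funext j l
    simp [residues, hfg]
  refine ⟨N.linearCode E g B C D dec, ?_⟩
  have hcard : ((T.image (residues q)).card : ℝ) / (Nat.card (ZMod q) : ℝ) ^ m' ≤
      T.card / (q : ℝ) ^ m' := by
    rw [Nat.card_zmod]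
    gcongr
    exact Finset.card_image_le
  refine le_trans ?_ (add_le_add le_rfl (hB.trans hcard))
  rw [BlockCode.errorProb, ← Finset.sum_add_distrib]
  refine Finset.sum_le_sum fun s _ => ?_
  by_cases herr : ∃ j, (N.linearCode E g B C D dec).decode j
      ((N.linearCode E g B C D dec).received s n N.receiver) ≠ f (s j)
  swap
  · rw [if_neg herr]
    refine add_nonneg ?_ ?_ <;> split_ifs <;> first | exact hp s | exact le_rfl
  rw [if_pos herr]
  by_cases hT : (fun j => f (s j)) ∈ T
  swap
  · rw [if_pos hT]
    refine le_add_of_nonneg_right ?_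
    split_ifs <;> first | exact hp s | exact le_rfl
  rw [if_neg (not_not.2 hT), zero_add, if_pos]
  obtain ⟨j, hj⟩ := herr
  change dec (D ((N.linearCode E g B C D dec).received s n N.receiver)) j ≠ f (s j) at hj
  have hex : ∃ u ∈ T, B (residues q u) = B (residues q fun j => f (s j)) := ⟨_, hT, rfl⟩
  rw [hrecv, show dec (B (residues q fun j => f (s j))) = hex.choose from dif_pos hex] at hj
  obtain ⟨huT, huB⟩ := hex.choose_spec
  refine ⟨_, Finset.mem_image_of_mem _ huT, fun heq => hj ?_, huB⟩
  -- Residues are only known to separate values of `f`, so the chosen entry is first written as some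
  -- `f s'`.
  have hu := Fintype.mem_piFinset.1 (Finset.mem_filter.1 huT).1 j
  obtain ⟨s', hs'⟩ : ∃ s', f s' = hex.choose j := by simpa using hu
  rw [← hs']
  refine hinj _ _ fun l => ?_
  rw [hs']
  exact congrFun (congrFun heq j) l

end FiniteFieldNetwork

/-! ### The cut-set converse -/

theorem card_image_le_of_determined {S A B C : Type*} [Fintype S] [DecidableEq A] [DecidableEq B]
    [DecidableEq C] (a : S → A) (b : S → B) (h : S → C)
    (hdet : ∀ s s', a s = a s' → b s = b s' → h s = h s') :
    (Finset.univ.image h).card ≤ (Finset.univ.image a).card * (Finset.univ.image b).card := by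
  rw [← Finset.card_product]
  refine Finset.card_le_card_of_forall_subsingleton
    (fun c ab => ∃ s, h s = c ∧ (a s, b s) = ab) ?_ ?_
  · intro c hc
    obtain ⟨s, _, hs⟩ := Finset.mem_image.1 hc
    exact ⟨(a s, b s), by simp, s, hs, rfl⟩
  · rintro ab _ c ⟨_, s, rfl, hs⟩ c' ⟨_, s', rfl, hs'⟩
    have := hs.trans hs'.symm
    exact hdet s s' (congrArg Prod.fst this) (congrArg Prod.snd this)

namespace FiniteFieldNetwork

open scoped Classical

variable {q K p : ℕ} {V : Type*} [Fintype V]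

theorem errorProb_nonneg {N : FiniteFieldNetwork q K V} {Y : Type*} {k n : ℕ}
    (c : N.BlockCode p Y k n) (P : PMF (Fin K → Fin p)) (f : (Fin K → Fin p) → Y) :
    0 ≤ c.errorProb P f :=
  Finset.sum_nonneg fun s _ => by
    split_ifs
    · exact Finset.prod_nonneg fun j _ => ENNReal.toReal_nonneg
    · exact le_rfl

variable [Fact q.Prime]

/-- Number of possible sequences received outside a cut. -/
theorem card_image_received_le {N : FiniteFieldNetwork q K V} {Y : Type*} {k n : ℕ}
    (c : N.BlockCode p Y k n) {Ω : Finset V} (hΩ : N.IsCut Set.univ Ω) (t : ℕ) :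
    (Finset.univ.image fun (s : Fin k → Fin K → Fin p) (v : {v : V // v ∉ Ω}) =>
      c.received s t v.1).card ≤ (q ^ (N.transferMatrix Set.univ Ω).rank) ^ t := by
  induction t with
  | zero =>
    rw [pow_zero, Finset.card_le_one]
    intro a _ b _
    funext v τ
    exact τ.elim0
  | succ t ih =>
    set H := N.transferMatrix Set.univ Ω
    let x : (Fin k → Fin K → Fin p) → ∀ u, Fin (N.inDim u) → ZMod q := fun s u =>
      if u = N.receiver then 0 else c.encode u t (fun i j => s j i.1) (c.received s t u)
    let X : (Fin k → Fin K → Fin p) → ((u : {u : V // u ∈ Ω}) × Fin (N.inDim u.1)) → ZMod q :=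
      fun s a => x s a.1.1 a.2
    have hcard : (Finset.univ.image fun s => H.mulVec (X s)).card ≤ q ^ H.rank := by
      have h1 : Nat.card (LinearMap.range H.mulVecLin) = q ^ H.rank := by
        rw [Module.natCard_eq_pow_finrank (K := ZMod q), Nat.card_zmod]
        rfl
      rw [← h1, Nat.card_eq_fintype_card, Fintype.card_subtype]
      refine Finset.card_le_card fun y hy => ?_
      obtain ⟨s, _, rfl⟩ := Finset.mem_image.1 hy
      simp only [Finset.mem_filter, Finset.mem_univ, true_and]
      exact ⟨X s, rfl⟩
    rw [pow_succ]
    refine le_trans (card_image_le_of_determined _ (fun s => H.mulVec (X s)) _ ?_)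
      (Nat.mul_le_mul ih hcard)
    intro s s' hst hH
    have hst' : ∀ v, v ∉ Ω → c.received s t v = c.received s' t v := fun v hv =>
      congrFun hst ⟨v, hv⟩
    -- All senders lie in `Ω`, so a node outside observes no source and its signal depends on its
    -- receptions alone.
    have hx : ∀ u, u ∉ Ω → x s u = x s' u := by
      intro u hu
      simp only [x]
      split_ifs
      · rfl
      · rw [hst' u hu]
        congr 1
        funext i
        exact absurd (i.2 ▸ hΩ.2.1 i.1 (Set.mem_univ _)) hu
    have hin : ∀ v ∉ Ω, ∑ u ∈ Ω, (if N.graph.Adj u v then (N.chan u v).mulVec (x s u) else 0) =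
        ∑ u ∈ Ω, (if N.graph.Adj u v then (N.chan u v).mulVec (x s' u) else 0) := by
      intro v hv
      by_cases hvr : v ∈ N.reachable Set.univ
      · have key : ∀ s row, H.mulVec (X s) ⟨⟨v, hvr, hv⟩, row⟩ =
            (∑ u ∈ Ω, (if N.graph.Adj u v then (N.chan u v).mulVec (x s u) else 0)) row := by
          intro s row
          rw [Finset.sum_apply, ← Finset.sum_coe_sort Ω]
          simp only [Matrix.mulVec, dotProduct, Fintype.sum_sigma]
          refine Finset.sum_congr rfl fun u _ => ?_
          simp only [H, transferMatrix, Matrix.of_apply]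
          split_ifs
          · rfl
          · simp
        funext row
        rw [← key s, ← key s', hH]
      -- The transfer matrix omits unreachable nodes, but these have no incoming edge from `Ω`.
      · refine Finset.sum_congr rfl fun u hu => ?_
        rw [if_neg, if_neg] <;>
        · intro hadj
          obtain ⟨i, hi, hpath⟩ := hΩ.1 u hu
          exact hvr ⟨i, hi, hpath.tail hadj⟩
    funext v
    rw [BlockCode.received, BlockCode.received, hst' v.1 v.2]
    congr 1
    change N.channelOutput (x s) v.1 = N.channelOutput (x s') v.1
    unfold channelOutput
    rw [← Finset.sum_add_sum_compl Ω, ← Finset.sum_add_sum_compl Ω, hin v.1 v.2]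
    congr 1
    refine Finset.sum_congr rfl fun u hu => ?_
    rw [hx u (Finset.mem_compl.1 hu)]

/-- The infimum is attained once some cut exists; all reachable nodes other than the receiver form
one. -/
theorem exists_isCut_minCutRank (N : FiniteFieldNetwork q K V) :
    ∃ Ω, N.IsCut Set.univ Ω ∧ N.minCutRank Set.univ = (N.transferMatrix Set.univ Ω).rank := by
  refine Nat.sInf_mem (s := {r : ℕ | ∃ Ω : Finset V, N.IsCut Set.univ Ω ∧
    r = (N.transferMatrix Set.univ Ω).rank}) ⟨_, Finset.univ.filter fun v =>
      v ∈ N.reachable Set.univ ∧ v ≠ N.receiver, ?_, rfl⟩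
  refine ⟨fun v hv => (Finset.mem_filter.1 hv).2.1, fun i _ => ?_, by simp⟩
  simp only [Finset.mem_filter, Finset.mem_univ, true_and]
  exact ⟨⟨i, Set.mem_univ _, .refl⟩, N.sender_ne_receiver i⟩

/-- Strong converse for a single code: a correct estimate is a likely value sequence or one of the
few that can be told apart across a minimum cut. -/
theorem one_le_errorProb_add {N : FiniteFieldNetwork q K V} {Y : Type*} {k n : ℕ}
    (c : N.BlockCode p Y k n) (P : PMF (Fin K → Fin p)) (f : (Fin K → Fin p) → Y) {δ : ℝ}
    (hδ : 0 ≤ δ) :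
    1 ≤ c.errorProb P f + ((∑ s : Fin k → Fin K → Fin p,
      (if (fun j => f (s j)) ∈ likelySeqs P f k δ then ∏ j, (P (s j)).toReal else 0)) +
        (q : ℝ) ^ (N.minCutRank Set.univ * n) * δ) := by
  obtain ⟨Ω, hΩ, hrank⟩ := N.exists_isCut_minCutRank
  let R := Finset.univ.image fun (s : Fin k → Fin K → Fin p) (v : {v : V // v ∉ Ω}) =>
      c.received s n v.1
  let D : Finset (Fin k → Y) := R.image fun y j => c.decode j (y ⟨N.receiver, hΩ.2.2⟩)
  have hD : (D.card : ℝ) ≤ (q : ℝ) ^ (N.minCutRank Set.univ * n) := by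
    rw [hrank, pow_mul]
    exact_mod_cast Finset.card_image_le.trans (card_image_received_le c hΩ n)
  have hsum := sum_mem_le P f k D hδ
  have hp : ∀ s : Fin k → Fin K → Fin p, 0 ≤ ∏ j, (P (s j)).toReal := fun s =>
    Finset.prod_nonneg fun j _ => ENNReal.toReal_nonneg
  have h1 : 1 ≤ c.errorProb P f + ∑ s : Fin k → Fin K → Fin p,
      (if (fun j => f (s j)) ∈ D then ∏ j, (P (s j)).toReal else 0) := by
    rw [← sum_prod_toReal_pmf P k, BlockCode.errorProb, ← Finset.sum_add_distrib]
    refine Finset.sum_le_sum fun s _ => ?_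
    by_cases herr : ∃ j, c.decode j (c.received s n N.receiver) ≠ f (s j)
    · rw [if_pos herr]
      refine le_add_of_nonneg_right ?_
      split_ifs <;> first | exact hp s | exact le_rfl
    · rw [if_neg herr, zero_add, if_pos]
      push Not at herr
      exact Finset.mem_image.2 ⟨_, Finset.mem_image_of_mem _ (Finset.mem_univ s), funext herr⟩
  have h2 := mul_le_mul_of_nonneg_right hD hδ
  linarith

/-- The cut-set bound. -/
theorem AchievableRate.le {N : FiniteFieldNetwork q K V} {Y : Type*} {P : PMF (Fin K → Fin p)}
    {f : (Fin K → Fin p) → Y} (hH : 0 < pmfEntropy P f) {R : ℝ} (hR : N.AchievableRate P f R) :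
    R ≤ N.minCutRank Set.univ * Real.log q / pmfEntropy P f := by
  obtain ⟨k, c, hk, herr⟩ := hR
  set r := N.minCutRank Set.univ
  set H := pmfEntropy P f
  have hq1 : (1 : ℝ) < q := by exact_mod_cast (Fact.out : q.Prime).one_lt
  have hlog : 0 < Real.log q := Real.log_pos hq1
  by_contra! hlt
  have hR0 : 0 < R := lt_of_le_of_lt (by positivity) hlt
  rw [div_lt_iff₀ hH] at hlt
  obtain ⟨ε, hε, hRε⟩ : ∃ ε : ℝ, 0 < ε ∧ r * Real.log q < R * (H - ε) := by
    -- This choice puts `R * (H - ε)` halfway between `r * log q` and `R * H`.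
    refine ⟨(R * H - r * Real.log q) / (2 * R), div_pos (by linarith) (by linarith), ?_⟩
    have : R * (H - (R * H - r * Real.log q) / (2 * R)) = (R * H + r * Real.log q) / 2 := by
      field_simp
      ring
    linarith
  obtain ⟨η, hη1, hη2⟩ := exists_between hRε
  obtain ⟨ρ, hρ0, hρ1, hρ⟩ := exists_prob_likely_le P f hε
  have hkinf : Tendsto k atTop atTop := by
    have h1 : Tendsto (fun n : ℕ => (k n : ℝ) / n * n) atTop atTop :=
      hk.pos_mul_atTop hR0 tendsto_natCast_atTop_atTop
    refine tendsto_natCast_atTop_iff.1 (h1.congr' ?_)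
    filter_upwards [eventually_gt_atTop 0] with n hn
    field_simp
  have hpow : Tendsto (fun n => ρ ^ k n) atTop (𝓝 0) :=
    (tendsto_pow_atTop_nhds_zero_of_lt_one hρ0 hρ1).comp hkinf
  have hexp : Tendsto (fun n : ℕ => Real.exp (-(η - r * Real.log q)) ^ n) atTop (𝓝 0) :=
    tendsto_pow_atTop_nhds_zero_of_lt_one (Real.exp_pos _).le
      (by rw [← Real.exp_zero]; exact Real.exp_lt_exp.2 (by linarith))
  have hlim := herr.add (hpow.add hexp)
  have hev : ∀ᶠ n in atTop, 1 ≤ (c n).errorProb P f +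
      (ρ ^ k n + Real.exp (-(η - r * Real.log q)) ^ n) := by
    have hk' : ∀ᶠ n : ℕ in atTop, η < (k n : ℝ) / n * (H - ε) :=
      (hk.mul_const (H - ε)).eventually (lt_mem_nhds hη2)
    filter_upwards [hk', eventually_gt_atTop 0] with n hn hn0
    have hn0' : (0 : ℝ) < n := by exact_mod_cast hn0
    refine (one_le_errorProb_add (c n) P f (Real.exp_pos (-(k n * (H - ε)))).le).trans ?_
    gcongr
    · exact hρ (k n)
    · have h1 : (q : ℝ) ^ (r * n) = Real.exp (n * (r * Real.log q)) := by
        rw [← Real.exp_log (show (0 : ℝ) < q by linarith), ← Real.exp_nat_mul, Real.log_exp]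
        push_cast
        ring_nf
      rw [h1, ← Real.exp_add, ← Real.exp_nat_mul]
      gcongr
      have : (k n : ℝ) * (H - ε) = n * ((k n : ℝ) / n * (H - ε)) := by
        field_simp
      rw [this]
      nlinarith
  have := ge_of_tendsto hlim hev
  norm_num at this

end FiniteFieldNetwork

/-! ### Asymptotics of achievability -/

/-- Near-optimal points of nonnegative functions that take arbitrarily small values eventually. -/
theorem exists_seq_tendsto_zero {A : ℕ → Type*} [∀ n, Nonempty (A n)] (d : ∀ n, A n → ℝ)
    (hd : ∀ n a, 0 ≤ d n a) (h : ∀ δ > 0, ∀ᶠ n in atTop, ∃ a, d n a < δ) :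
    ∃ a : ∀ n, A n, Tendsto (fun n => d n (a n)) atTop (𝓝 0) := by
  have h1 : ∀ n, ∃ a, d n a < (⨅ a, d n a) + 1 / ((n : ℝ) + 1) := fun n =>
    exists_lt_of_ciInf_lt (lt_add_of_pos_right _ (by positivity))
  choose a ha using h1
  refine ⟨a, ?_⟩
  rw [Metric.tendsto_atTop']
  intro δ hδ
  have h2 := (tendsto_one_div_add_atTop_nhds_zero_nat (𝕜 := ℝ)).eventually
    (gt_mem_nhds (half_pos hδ))
  obtain ⟨n₀, hn₀⟩ := eventually_atTop.1 (h2.and (h _ (half_pos hδ)))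
  refine ⟨n₀, fun n hn => ?_⟩
  obtain ⟨h3, b, hb⟩ := hn₀ n hn.le
  rw [Real.dist_0_eq_abs, abs_of_nonneg (hd n _)]
  have h4 : ⨅ a, d n a ≤ d n b := ciInf_le ⟨0, by rintro _ ⟨a, rfl⟩; exact hd n a⟩ b
  have := ha n
  linarith

namespace FiniteFieldNetwork

open scoped Classical

variable {q K p : ℕ} [Fact q.Prime] {V : Type*} [Fintype V]

/-- A diagonal argument: the codes may depend on `δ`. It puts the limiting rate itself, and not only
smaller ones, in the achievable set. -/
theorem achievableRate_of_forall_eventually {N : FiniteFieldNetwork q K V} {Y : Type*}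
    {P : PMF (Fin K → Fin p)} {f : (Fin K → Fin p) → Y} {R : ℝ}
    (h : ∀ δ > 0, ∀ᶠ n : ℕ in atTop, ∃ (k : ℕ) (c : N.BlockCode p Y k n),
      |(k : ℝ) / n - R| < δ ∧ c.errorProb P f < δ) : N.AchievableRate P f R := by
  have : ∀ n, Nonempty (Σ k, N.BlockCode p Y k n) := fun n =>
    ⟨⟨0, ⟨fun _ _ _ _ => 0, fun j => j.elim0⟩⟩⟩
  obtain ⟨a, ha⟩ := exists_seq_tendsto_zero (A := fun n => Σ k, N.BlockCode p Y k n)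
    (fun n a => max |(a.1 : ℝ) / n - R| (a.2.errorProb P f))
    (fun n a => le_max_of_le_left (abs_nonneg _)) (by
      intro δ hδ
      filter_upwards [h δ hδ] with n hn
      obtain ⟨k, c, h1, h2⟩ := hn
      exact ⟨⟨k, c⟩, max_lt h1 h2⟩)
  refine ⟨fun n => (a n).1, fun n => (a n).2, ?_, ?_⟩
  · rw [tendsto_iff_dist_tendsto_zero]
    exact squeeze_zero (fun n => dist_nonneg) (fun n => le_max_left _ _) ha
  · exact squeeze_zero (fun n => errorProb_nonneg _ P f) (fun n => le_max_right _ _) ha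

/-- For a fixed number `v` of nodes the bound is a polynomial in `n` times `q ^ (-r * n)`, which
beats `exp (n * b)`. -/
theorem tendsto_failBound {q r v : ℕ} [Fact q.Prime] (M : ℝ) {b : ℝ}
    (hb : b < r * Real.log q) :
    Tendsto (fun n : ℕ => M * Real.exp (n * b) * failBound ((q : ℝ) ^ r) n v) atTop (𝓝 0) := by
  have hq0 : (0 : ℝ) < q := by exact_mod_cast (Fact.out : q.Prime).pos
  set ρ := Real.exp (b - r * Real.log q)
  have hρ : |ρ| < 1 := by
    rw [abs_of_pos (Real.exp_pos _), ← Real.exp_zero]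
    exact Real.exp_lt_exp.2 (by linarith)
  have h1 := (tendsto_add_atTop_iff_nat 1).2 (tendsto_pow_const_mul_const_pow_of_abs_lt_one v hρ)
  have h2 := h1.const_mul (M * ((q : ℝ) ^ r) ^ v / ρ)
  rw [mul_zero] at h2
  refine h2.congr fun n => ?_
  have h3 : Real.exp (n * b) / ((q : ℝ) ^ r) ^ n = ρ ^ n := by
    have : ((q : ℝ) ^ r) ^ n = Real.exp (n * (r * Real.log q)) := by
      rw [Real.exp_nat_mul, Real.exp_nat_mul, Real.exp_log hq0]
    rw [this, ← Real.exp_sub, ← Real.exp_nat_mul]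
    ring_nf
  have hρ0 : ρ ≠ 0 := (Real.exp_pos _).ne'
  rw [failBound, mul_pow, pow_succ ρ, ← h3]
  push_cast
  field_simp

theorem exists_pow_near_exp {b : ℝ} (hb : 1 < b) {x : ℝ} (hx : 0 ≤ x) :
    ∃ m : ℕ, Real.exp x ≤ b ^ m ∧ b ^ m ≤ b * Real.exp x := by
  have hlog : 0 < Real.log b := Real.log_pos hb
  have h1 : b ^ ⌈x / Real.log b⌉₊ = Real.exp (⌈x / Real.log b⌉₊ * Real.log b) := by
    rw [Real.exp_nat_mul, Real.exp_log (by linarith)]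
  refine ⟨⌈x / Real.log b⌉₊, ?_, ?_⟩
  · rw [h1, Real.exp_le_exp, ← div_le_iff₀ hlog]
    exact Nat.le_ceil _
  · have h2 : b * Real.exp x = Real.exp (Real.log b + x) := by
      rw [Real.exp_add, Real.exp_log (by linarith)]
    rw [h1, h2, Real.exp_le_exp]
    have h3 := mul_le_mul_of_nonneg_right (Nat.ceil_lt_add_one (div_nonneg hx hlog.le)).le hlog.le
    rw [add_mul, one_mul, div_mul_cancel₀ _ hlog.ne'] at h3
    linarith

/-- A block code for `k` values when the hash length is chosen just above `k * (H + 2 * ε)`. -/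
theorem exists_code_of_entropy (N : FiniteFieldNetwork q K V) (P : PMF (Fin K → Fin p)) {L : ℕ}
    (f : (Fin K → Fin p) → Fin L → ℕ) (g : Fin K → Fin p → Fin L → ZMod q)
    (hfg : ∀ s l, (f s l : ZMod q) = ∑ i, g i (s i) l)
    (hinj : ∀ s s', (∀ l, (f s l : ZMod q) = f s' l) → f s = f s')
    (hH : 0 < pmfEntropy P f) {r : ℕ} (hr : ∀ i, r ≤ N.minCutRank {i}) {k n : ℕ} {ε x : ℝ}
    (hε : 0 < ε) (hx : k * (pmfEntropy P f + 2 * ε) ≤ x)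
    (hfail : K * q ^ (K + 1) * Real.exp x * failBound ((q : ℝ) ^ r) n (Fintype.card V) < 1) :
    ∃ c : N.BlockCode p (Fin L → ℕ) k n, c.errorProb P f ≤
      (∑ s : Fin k → Fin K → Fin p, (if (fun j => f (s j)) ∉
        likelySeqs P f k (Real.exp (-(k * (pmfEntropy P f + ε)))) then
          ∏ j, (P (s j)).toReal else 0)) + Real.exp (-ε) ^ k := by
  have hq := (Fact.out : q.Prime).one_lt
  have hq1 : (1 : ℝ) < q := by exact_mod_cast hq
  obtain ⟨m', hm'1, hm'2⟩ := exists_pow_near_exp hq1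
    (show 0 ≤ (k : ℝ) * (pmfEntropy P f + 2 * ε) from
      mul_nonneg (Nat.cast_nonneg _) (by linarith))
  replace hm'2 : (q : ℝ) ^ m' ≤ q * Real.exp x :=
    hm'2.trans (mul_le_mul_of_nonneg_left (Real.exp_le_exp.2 hx) (by linarith))
  have hnn : 0 ≤ failBound ((q : ℝ) ^ r) n (Fintype.card V) :=
    failBound_nonneg (one_le_cast_pow q r) _ _
  have hm : (K : ℝ) * q ^ (m' + K) * failBound ((q : ℝ) ^ r) n (Fintype.card V) < 1 := by
    refine lt_of_le_of_lt (mul_le_mul_of_nonneg_right ?_ hnn) hfail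
    calc (K : ℝ) * q ^ (m' + K) = K * q ^ K * q ^ m' := by ring
      _ ≤ K * q ^ K * (q * Real.exp x) := by gcongr
      _ = _ := by ring
  -- The message is `K` symbols longer than the hash because `K < q ^ K`; this constant overhead
  -- does not affect the rate.
  have hm' : K * q ^ m' < q ^ (m' + K) := by
    rw [pow_add, mul_comm]
    exact Nat.mul_lt_mul_of_pos_left (Nat.lt_pow_self hq) (pow_pos (by omega) _)
  obtain ⟨c, hc⟩ := N.exists_code P f g hfg hinj hr hm hm' k
    (Real.exp (-(k * (pmfEntropy P f + ε))))
  refine ⟨c, hc.trans (add_le_add le_rfl ?_)⟩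
  have hcard := card_likelySeqs_mul_le P f k (Real.exp (-(k * (pmfEntropy P f + ε))))
  rw [div_le_iff₀ (pow_pos (by linarith) _)]
  generalize ((likelySeqs P f k (Real.exp (-(k * (pmfEntropy P f + ε))))).card : ℝ) = M
    at hcard ⊢
  rw [Real.exp_neg, ← div_eq_mul_inv, div_le_one (Real.exp_pos _)] at hcard
  refine hcard.trans ?_
  have h1 : Real.exp (k * (pmfEntropy P f + ε)) =
      Real.exp (-ε) ^ k * Real.exp (k * (pmfEntropy P f + 2 * ε)) := by
    rw [← Real.exp_nat_mul, ← Real.exp_add]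
    ring_nf
  rw [h1]
  exact mul_le_mul_of_nonneg_left hm'1 (pow_nonneg (Real.exp_pos _).le _)

/-- Every rate up to the smallest individual min-cut rank is achievable. -/
theorem achievableRate_minCut (N : FiniteFieldNetwork q K V) (P : PMF (Fin K → Fin p)) {L : ℕ}
    (f : (Fin K → Fin p) → Fin L → ℕ) (g : Fin K → Fin p → Fin L → ZMod q)
    (hfg : ∀ s l, (f s l : ZMod q) = ∑ i, g i (s i) l)
    (hinj : ∀ s s', (∀ l, (f s l : ZMod q) = f s' l) → f s = f s')
    (hH : 0 < pmfEntropy P f) {r : ℕ} (hr : ∀ i, r ≤ N.minCutRank {i}) :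
    N.AchievableRate P f (r * Real.log q / pmfEntropy P f) := by
  refine achievableRate_of_forall_eventually fun δ hδ => ?_
  set H := pmfEntropy P f
  have hq := (Fact.out : q.Prime).one_lt
  have hq1 : (1 : ℝ) < q := by exact_mod_cast hq
  have hlog : 0 < Real.log q := Real.log_pos hq1
  -- At min-cut rank zero the code for no values suffices; otherwise a positive rate `R` just below
  -- the target exists.
  rcases Nat.eq_zero_or_pos r with rfl | hr0
  · refine Eventually.of_forall fun n => ⟨0, ⟨fun _ _ _ _ => 0, fun j => j.elim0⟩, ?_, ?_⟩
    · simpa using hδ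
    · simpa [BlockCode.errorProb] using hδ
  set C := r * Real.log q / H with hC
  have hC0 : 0 < C := by positivity
  obtain ⟨R, hR1, hR2⟩ := exists_between (max_lt (sub_lt_self C hδ) hC0)
  have hR0 : 0 < R := (le_max_right _ _).trans_lt hR1
  have hRδ : C - δ < R := (le_max_left _ _).trans_lt hR1
  rw [hC, lt_div_iff₀ hH] at hR2
  obtain ⟨ε, hε, hRε⟩ : ∃ ε : ℝ, 0 < ε ∧ R * (H + 2 * ε) < r * Real.log q := by
    -- Here `R * (H + 2 * ε)` is the midpoint of `R * H` and `r * log q`. One `ε` covers typicality,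
    -- the other makes hash collisions rare.
    refine ⟨(r * Real.log q - R * H) / (4 * R), div_pos (by linarith) (by linarith), ?_⟩
    have : R * (H + 2 * ((r * Real.log q - R * H) / (4 * R))) = (R * H + r * Real.log q) / 2 := by
      field_simp
      ring
    linarith
  obtain ⟨ρ, hρ0, hρ1, hρ⟩ := exists_prob_unlikely_le P f hε
  obtain ⟨k, hkR, hkinf, hkn⟩ : ∃ k : ℕ → ℕ, Tendsto (fun n : ℕ => (k n : ℝ) / n) atTop (𝓝 R) ∧
      Tendsto k atTop atTop ∧ ∀ n, (k n : ℝ) ≤ R * n :=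
    ⟨fun n => ⌊R * (n : ℝ)⌋₊,
      (tendsto_nat_floor_mul_div_atTop hR0.le).comp tendsto_natCast_atTop_atTop,
      tendsto_nat_floor_atTop.comp (tendsto_natCast_atTop_atTop.const_mul_atTop hR0),
      fun n => Nat.floor_le (by positivity)⟩
  have hkdist : ∀ᶠ n : ℕ in atTop, |(k n : ℝ) / n - C| < δ := by
    have hCR : |R - C| < δ := by
      rw [abs_lt]
      constructor
      · linarith
      · have : R < C := by rw [hC, lt_div_iff₀ hH]; exact hR2
        linarith
    exact (hkR.sub_const C).abs.eventually (gt_mem_nhds hCR)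
  have herr : ∀ᶠ n in atTop, ρ ^ k n + Real.exp (-ε) ^ k n < δ := by
    have h1 := (tendsto_pow_atTop_nhds_zero_of_lt_one hρ0 hρ1).add
      (tendsto_pow_atTop_nhds_zero_of_lt_one (Real.exp_pos (-ε)).le
        (by rw [← Real.exp_zero]; exact Real.exp_lt_exp.2 (by linarith)))
    rw [add_zero] at h1
    exact (h1.comp hkinf).eventually (gt_mem_nhds hδ)
  have hfail := (tendsto_failBound (q := q) (r := r) (v := Fintype.card V) (K * q ^ (K + 1))
    hRε).eventually (gt_mem_nhds one_pos)
  filter_upwards [hkdist, herr, hfail] with n h1 h2 h3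
  have hx := mul_le_mul_of_nonneg_right (hkn n) (show 0 ≤ H + 2 * ε by linarith)
  rw [show R * n * (H + 2 * ε) = n * (R * (H + 2 * ε)) by ring] at hx
  obtain ⟨c, hc⟩ := N.exists_code_of_entropy P f g hfg hinj hH hr hε hx h3
  refine ⟨k n, c, h1, (hc.trans (add_le_add ?_ le_rfl)).trans_lt h2⟩
  refine Eq.trans_le ?_ (hρ (k n))
  congr!

theorem isComputationCapacity_minCut (N : FiniteFieldNetwork q K V) (P : PMF (Fin K → Fin p))
    (hcut : N.minCutRank Set.univ = ⨅ i : Fin K, N.minCutRank {i}) {L : ℕ}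
    (f : (Fin K → Fin p) → Fin L → ℕ) (g : Fin K → Fin p → Fin L → ZMod q)
    (hfg : ∀ s l, (f s l : ZMod q) = ∑ i, g i (s i) l)
    (hinj : ∀ s s', (∀ l, (f s l : ZMod q) = f s' l) → f s = f s')
    (hH : 0 < pmfEntropy P f) :
    N.IsComputationCapacity P f
      (((⨅ i : Fin K, N.minCutRank {i} : ℕ) : ℝ) * Real.log q / pmfEntropy P f) :=
  ⟨N.achievableRate_minCut P f g hfg hinj hH fun i => ciInf_le (OrderBot.bddBelow _) i,
    fun _ hR => hcut ▸ AchievableRate.le hH hR⟩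

/-- No wraparound: this is how the lower bound on `q` enters. -/
theorem eq_of_natCast_eq {L : ℕ} {u u' : Fin L → ℕ} (hu : ∀ l, u l < q) (hu' : ∀ l, u' l < q)
    (h : ∀ l, (u l : ZMod q) = u' l) : u = u' := by
  funext l
  have := (ZMod.natCast_eq_natCast_iff' _ _ _).1 (h l)
  rwa [Nat.mod_eq_of_lt (hu l), Nat.mod_eq_of_lt (hu' l)] at this

end FiniteFieldNetwork

/-! ### Arithmetic sums and types -/

theorem arithmeticSum_le {K p L : ℕ} (a : Fin L → Fin K → Fin p) (s : Fin K → Fin p) (l : Fin L) :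
    arithmeticSum a s l ≤ (p - 1) ^ 2 * K := by
  refine (Finset.sum_le_card_nsmul _ _ ((p - 1) ^ 2) fun i _ => ?_).trans_eq ?_
  · rw [sq]
    exact Nat.mul_le_mul (by omega) (by omega)
  · simp [mul_comm]

theorem typeFunction_le {K p : ℕ} (s : Fin K → Fin p) (l : Fin p) : typeFunction s l ≤ K := by
  refine (Finset.sum_le_card_nsmul _ _ 1 fun i _ => ?_).trans_eq ?_
  · split_ifs <;> simp
  · simp

theorem mainTheorem3 {q K p : ℕ} [Fact q.Prime] {V : Type*} [Fintype V]
    (N : FiniteFieldNetwork q K V) (P : PMF (Fin K → Fin p))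
    (hq : (p - 1) ^ 2 * K < q)
    (hcut : N.minCutRank Set.univ = ⨅ i : Fin K, N.minCutRank {i}) :
    (∀ (L : ℕ) (a : Fin L → Fin K → Fin p), 0 < pmfEntropy P (arithmeticSum a) →
      N.IsComputationCapacity P (arithmeticSum a)
        (((⨅ i : Fin K, N.minCutRank {i} : ℕ) : ℝ) * Real.log q /
          pmfEntropy P (arithmeticSum a))) ∧
    (0 < pmfEntropy P (typeFunction (K := K) (p := p)) →
      N.IsComputationCapacity P typeFunction
        (((⨅ i : Fin K, N.minCutRank {i} : ℕ) : ℝ) * Real.log q /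
          pmfEntropy P (typeFunction (K := K) (p := p)))) := by
  refine ⟨fun L a hH => ?_, fun hH => ?_⟩
  · refine N.isComputationCapacity_minCut P hcut _
      (fun i x l => ((a l i : ℕ) : ZMod q) * ((x : ℕ) : ZMod q)) (fun s l => ?_)
      (fun s s' => FiniteFieldNetwork.eq_of_natCast_eq
        (fun l => (arithmeticSum_le a s l).trans_lt hq)
        (fun l => (arithmeticSum_le a s' l).trans_lt hq)) hH
    simp [arithmeticSum]
  · refine N.isComputationCapacity_minCut P hcut _
      (fun i x l => if x = l then 1 else 0) (fun s l => ?_) (fun s s' h => ?_) hH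
    · simp [typeFunction]
    -- For `p ≤ 1` the hypothesis on `q` does not give `K < q`, but then the source is constant.
    · rcases Nat.lt_or_ge 1 p with hp | hp
      · have hK : K < q := lt_of_le_of_lt
          (Nat.le_mul_of_pos_left K (pow_pos (by omega) 2)) hq
        exact FiniteFieldNetwork.eq_of_natCast_eq (fun l => (typeFunction_le s l).trans_lt hK)
          (fun l => (typeFunction_le s' l).trans_lt hK) h
      · have : Subsingleton (Fin p) := Fin.subsingleton_iff_le_one.2 hp
        rw [Subsingleton.elim s s']
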